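/- **Setting.** Let $\mathcal N=\{1,\dots,N\}$ be aggregators and $\{1,\dots,H\}$ lines. The data are $r\ge 0$, $\alpha>0$, bounds $\underline\beta,\bar\beta\in\mathbb R$, $a_n,b_n>0$, $\hat x_n,e_n\in\mathbb R$ ($n\in\mathcal N$), $\hat f\in\mathbb R_+^H$ and $\Pi\in\mathbb R^{H\times N}$. For $\beta\in\mathbb R^N$ put $p=\frac{r-\mathbb 1^\top\beta}{\alpha N}$, $x_n=\frac{r-\mathbb 1^\top\beta}{N}+\beta_n$, $C_n(x)=(a_nx+b_n)x$ and $\bar J_n(\beta)=C_n(x_n)-p\,x_n$. Let $A=I-\frac1N\mathbb 1\mathbb 1^\top$, $c=\frac rN\mathbb 1$, $M=2N+2H$, $$\tilde A=\begin{bmatrix}A\\-A\\-\Pi A\\ \Pi A\end{bmatrix},\qquad d=\begin{bmatrix}\hat x-c\\ c\\ \hat f-\Pi(e-c)\\ \hat f+\Pi(e-c)\end{bmatrix}=\sum_{n}d_n,\qquad d_n=\frac1N\begin{bmatrix}-c\\ c\\ \hat f+\Pi c\\ \hat f-\Pi c\end{bmatrix}+\begin{bmatrix}\hat x_n\mathbf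 e_n\\0\\-e_n\Pi\mathbf e_n\\ e_n\Pi\mathbf e_n\end{bmatrix},$$ with $\mathbf e_n$ the $n$-th unit vector, and let $\tilde A_n$ be the $n$-th column of $\tilde A$. Let $\Omega_n=[\underline\beta,\bar\beta]$, $\Omega=\prod_n\Omega_n$, $K_n(\beta_{-n})=\{\beta_n\in\Omega_n:\tilde A_n\beta_n\le d-\sum_{m\ne n}\tilde A_m\beta_m\}$ and $K=\{\beta\in\Omega:\tilde A\beta\le d\}$, and assume Slater's condition: $\tilde A\beta<d$ (componentwise) for some $\beta\in\Omega$. In the game $\mathcal G$ aggregator $n$ minimizes $\bar J_n(\cdot,\beta_{-n})$ over $K_n(\beta_{-n})$. A GNE is a $\beta^*\in K$ with $\bar J_n(\beta_n^*,\beta_{-n}^*)\le\bar J_n(\beta_n,\beta_{-n}^*)$ for all $n$ and all $\beta_n\in K_n(\beta_{-n}^*)$. A variational GNE (v-GNE) is a GNE that solves $\mathrm{VI}(K,F)$, i.e. $(\beta-\beta^*)^\top F(\beta^*)\ge0$ for all $\beta\in K$, where $F=\operatorname{col}(\partial\bar J_n/\partial\beta_n)_n$. Put $$\hat f_n(\beta_n,\sigma_n)=\tfrac{N-1}{N}C_n'\!\left(\tfrac{r-N\sigma_n}{N}+\beta_n\right)+\tfrac{(N\sigma_n-r)(N-2)+N\beta_n}{\alpha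 N^2},\qquad \hat F(\beta,\sigma)=\operatorname{col}(\hat f_n(\beta_n,\sigma_n))_n .$$ **Algorithm.** Let $L$ be the Laplacian of a connected undirected graph on $\mathcal N$ with weights $w_{nm}=w_{mn}$, positive on links and $0$ otherwise. Take $\kappa$ and step sizes $\tau_n,\upsilon_n,\rho_n,\delta_n,\eta_n>0$. Starting from $\beta^0\in\Omega$, $\sigma^0,\psi^0\in\mathbb R^N$, $z_n^0\in\mathbb R^M$, $\lambda_n^0\in\mathbb R^M_+$, iterate for all $n$ $$\begin{aligned} \beta_n^{k+1}&=\operatorname{proj}_{\Omega_n}\big[\beta_n^k-\tau_n(\hat f_n(\beta_n^k,\sigma_n^k)+\tilde A_n^\top\lambda_n^k)\big],\\ \psi_n^{k+1}&=\psi_n^k+\upsilon_n\textstyle\sum_m w_{nm}(\sigma_n^k-\sigma_m^k),\\ \sigma_n^{k+1}&=\sigma_n^k+\rho_n\big(\kappa(\beta_n^k-\sigma_n^k)-\textstyle\sum_m w_{nm}(2(\psi_n^{k+1}-\psi_m^{k+1})-(\psi_n^k-\psi_m^k))\big),\\ z_n^{k+1}&=z_n^k+\delta_n\textstyle\sum_m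 w_{nm}(\lambda_n^k-\lambda_m^k),\\ \lambda_n^{k+1}&=\operatorname{proj}_{\mathbb R_+^M}\big[\lambda_n^k-\eta_n\big(\textstyle\sum_m w_{nm}(\lambda_n^k-\lambda_m^k)+d_n+\tilde A_n(\beta_n^k-2\beta_n^{k+1})+\sum_m w_{nm}(2(z_n^{k+1}-z_m^{k+1})-(z_n^k-z_m^k))\big)\big]. \end{aligned}$$ **Operators.** With $\bar A=\operatorname{blkdiag}(\tilde A_n)_n$, $\bar d=\operatorname{col}(d_n)_n$, $L_\lambda=L\otimes I_M$, and $\mathrm N_S(x)=\{v: v^\top(y-x)\le0\ \forall y\in S\}$ for $x\in S$, $\mathrm N_S(x)=\emptyset$ for $x\notin S$, define for $\omega=(\beta,\psi,\sigma,z,\lambda)$ $$\mathcal A(\omega)=\begin{bmatrix}\hat F(\beta,\sigma)\\0\\ \kappa(\sigma-\beta)\\0\\ \bar d+L_\lambda\lambda\end{bmatrix},\qquad \mathcal B(\omega)=\begin{bmatrix}\mathrm N_\Omega(\beta)+\bar A^\top\lambda\\-L\sigma\\L\psi\\-L_\lambda\lambda\\ \mathrm N_{\mathbb R_+^{NM}}(\lambda)-\bar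 A\beta+L_\lambda z\end{bmatrix}.$$ **Parameters.** Let $\mu_n=2a_n\frac{N-1}N+\frac1{\alpha N}$, $\ell_n=-2a_n\frac{N-1}N+\frac{N-2}{\alpha N}$, $\gamma=\sqrt{\frac{N-1}{\alpha N}}$, $$\bar\epsilon_n=\kappa+\mu_n-\sqrt{(\mu_n-\kappa)^2+(\ell_n-\kappa)^2},\qquad \underline\epsilon_n=\mu_n^2+\ell_n^2+2\kappa^2+\sqrt{(\mu_n+\ell_n)^2(\mu_n-\ell_n)^2+4(\kappa^2-\mu_n\ell_n)^2},$$ $\tilde\epsilon=\min_n\bar\epsilon_n/\max_n\underline\epsilon_n$ and $\epsilon=\min\{\tilde\epsilon,1/\lambda_{\max}(L)\}$. **Theorem.** Suppose $\kappa\in\big(\max_n(\sqrt{\mu_n}-\gamma)^2,\ \min_n(\sqrt{\mu_n}+\gamma)^2\big)$ and, for all $n\in\mathcal N$, $$\tau_n<2\epsilon,\quad\upsilon_n<2\epsilon,\quad\delta_n<2\epsilon,$$ $$\rho_n^{-1}>\lambda_{\max}^2(L)\Big(\tfrac1{\max_m\upsilon_m}-\tfrac1{2\epsilon}\Big)^{-1}+\tfrac1{2\epsilon},$$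 $$\eta_n^{-1}>\|\bar A\|^2\Big(\tfrac1{\max_m\tau_m}-\tfrac1{2\epsilon}\Big)^{-1}+\lambda_{\max}^2(L)\Big(\tfrac1{\max_m\delta_m}-\tfrac1{2\epsilon}\Big)^{-1}+\tfrac1{2\epsilon},$$ where $\|\bar A\|$ is the largest singular value. Then for every admissible initialization the iterates $\omega^k=(\beta^k,\psi^k,\sigma^k,z^k,\lambda^k)$ converge to some $\omega^*=(\beta^*,\psi^*,\sigma^*,z^*,\lambda^*)$ with $0\in\mathcal A(\omega^*)+\mathcal B(\omega^*)$. In particular $\beta^k\to\beta^*$, and $\beta^*$ is a v-GNE of $\mathcal G$. -/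

import Mathlib

open Filter Topology
open scoped Matrix Kronecker Pointwise

noncomputable section

namespace AggGame

/-! ### Convex-analytic notions -/

/-- Metric projection `argmin_{y ∈ S} ‖y - x‖`. -/
def proj {E : Type*} [NormedAddCommGroup E] (S : Set E) (x : E) : E :=
  Classical.epsilon fun p => p ∈ S ∧ ∀ y ∈ S, ‖p - x‖ ≤ ‖y - x‖

/-- On nonempty closed sets of a proper space the projection is a nearest point. -/
theorem proj_spec {E : Type*} [NormedAddCommGroup E] [ProperSpace E] {S : Set E}
    (hS : IsClosed S) (hne : S.Nonempty) (x : E) :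
    proj S x ∈ S ∧ ∀ y ∈ S, ‖proj S x - x‖ ≤ ‖y - x‖ := by
  have h : ∃ p, p ∈ S ∧ ∀ y ∈ S, ‖p - x‖ ≤ ‖y - x‖ := by
    obtain ⟨p, hp, hd⟩ := hS.exists_infDist_eq_dist hne x
    refine ⟨p, hp, fun y hy => ?_⟩
    rw [← dist_eq_norm, ← dist_eq_norm, dist_comm p x, dist_comm y x, ← hd]
    exact Metric.infDist_le_dist_of_mem hy
  exact Classical.epsilon_spec h

/-- Normal cone `N_S(x)`; it is empty when `x ∉ S`. -/
def normalCone {E : Type*} [NormedAddCommGroup E] [InnerProductSpace ℝ E]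
    (S : Set E) (x : E) : Set E :=
  {v | x ∈ S ∧ ∀ z ∈ S, inner ℝ v (z - x) ≤ 0}

/-- Largest eigenvalue (used for real symmetric matrices). -/
def lamMax {ι : Type*} [Fintype ι] [DecidableEq ι] (A : Matrix ι ι ℝ) : ℝ :=
  sSup (spectrum ℝ A)

/-- Largest singular value of a real matrix: its operator norm between Euclidean spaces. -/
def sigmaMax {ι κ : Type*} [Fintype ι] [Fintype κ] [DecidableEq κ] (A : Matrix ι κ ℝ) : ℝ :=
  ‖LinearMap.toContinuousLinearMap (Matrix.toEuclideanLin A)‖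

/-! ### The demand response game -/

/-- The data of the network with aggregators `Fin N` and lines `Fin H`. -/
structure Network (N H : ℕ) where
  /-- load adjustment requirement -/
  r : ℝ
  /-- price constant -/
  α : ℝ
  /-- minimum admissible bid -/
  lo : ℝ
  /-- maximum admissible bid -/
  hi : ℝ
  /-- coefficients of the pricing functions `q_n(x) = a_n x + b_n` -/
  a : Fin N → ℝ
  b : Fin N → ℝ
  /-- load adjustment capacities -/
  xhat : Fin N → ℝ
  /-- pre-scheduled net loads -/
  e : Fin N → ℝ
  /-- line capacities -/
  fhat : Fin H → ℝ
  /-- line flow distribution factors -/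
  flow : Matrix (Fin H) (Fin N) ℝ
  r_nonneg : 0 ≤ r
  α_pos : 0 < α
  a_pos : ∀ n, 0 < a n
  b_pos : ∀ n, 0 < b n
  fhat_nonneg : ∀ l, 0 ≤ fhat l

/-- Index set of the `M = 2N + 2H` coupling constraints. -/
abbrev CIdx (N H : ℕ) : Type := Fin N ⊕ Fin N ⊕ Fin H ⊕ Fin H

/-- `ℝ^N` with the Euclidean norm. -/
abbrev Vec (N : ℕ) : Type := EuclideanSpace ℝ (Fin N)

/-- `ℝ^M` with the Euclidean norm. -/
abbrev CVec (N H : ℕ) : Type := EuclideanSpace ℝ (CIdx N H)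

/-- `ℝ^{NM}` with the Euclidean norm. -/
abbrev BigVec (N H : ℕ) : Type := EuclideanSpace ℝ (Fin N × CIdx N H)

/-- The `n`-th block in `ℝ^M` of a stacked vector in `ℝ^{NM}`. -/
def block {N H : ℕ} (v : BigVec N H) (n : Fin N) : CVec N H :=
  WithLp.toLp 2 fun i => v (n, i)

namespace Network

variable {N H : ℕ} (g : Network N H)

/-- Clearing price `p`. -/
def price (β : Vec N) : ℝ := (g.r - ∑ m, β m) / (g.α * N)

/-- Clearing load adjustment `x_n`. -/
def load (β : Vec N) (n : Fin N) : ℝ := (g.r - ∑ m, β m) / N + β n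

/-- Payment `C_n(x) = q_n(x) x` to the prosumers. -/
def cost (n : Fin N) (x : ℝ) : ℝ := (g.a n * x + g.b n) * x

/-- The function `J̄_n`: the cost `C_n(x_n) - p x_n` in terms of the bids. -/
def J (n : Fin N) (β : Vec N) : ℝ :=
  g.cost n (g.load β n) - g.price β * g.load β n

/-- `A = I - (1/N) 𝟙 𝟙ᵀ`. -/
def A (_g : Network N H) : Matrix (Fin N) (Fin N) ℝ :=
  1 - (1 / (N : ℝ)) • Matrix.of fun _ _ => (1 : ℝ)

/-- `c = (r / N) 𝟙`. -/
def c : Fin N → ℝ := fun _ => g.r / N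

/-- `Ã`, stacking `A`, `-A`, `-Π A`, `Π A`. -/
def Atil : Matrix (CIdx N H) (Fin N) ℝ :=
  Matrix.fromRows g.A (Matrix.fromRows (-g.A)
    (Matrix.fromRows (-(g.flow * g.A)) (g.flow * g.A)))

/-- The right-hand side `d` of the coupling constraints `Ã β ≤ d`. -/
def d : CIdx N H → ℝ :=
  Sum.elim (g.xhat - g.c) (Sum.elim g.c
    (Sum.elim (g.fhat - g.flow *ᵥ (g.e - g.c)) (g.fhat + g.flow *ᵥ (g.e - g.c))))

/-- The local part `d_n` of `d`, containing only the private data `x̂_n`, `e_n` of `n`. -/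
def dLoc (n : Fin N) : CVec N H :=
  WithLp.toLp 2 <|
    (1 / (N : ℝ)) • Sum.elim (-g.c) (Sum.elim g.c
        (Sum.elim (g.fhat + g.flow *ᵥ g.c) (g.fhat - g.flow *ᵥ g.c)))
    + Sum.elim (Pi.single n (g.xhat n)) (0 : Fin N ⊕ Fin H ⊕ Fin H → ℝ)
    + Sum.elim (0 : Fin N → ℝ) (Sum.elim (0 : Fin N → ℝ) (Sum.elim (-(g.flow *ᵥ Pi.single n (g.e n)))
        (g.flow *ᵥ Pi.single n (g.e n))))

/-- The box `Ω` of admissible bids. -/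
def Omega : Set (Vec N) := {β | ∀ n, β n ∈ Set.Icc g.lo g.hi}

/-- The jointly feasible bids `K`. -/
def K : Set (Vec N) := {β | β ∈ g.Omega ∧ ∀ i, (g.Atil *ᵥ β) i ≤ g.d i}

/-- The feasible bids `K_n(β_{-n})` of aggregator `n` (independent of `β n`). -/
def Kn (n : Fin N) (β : Vec N) : Set ℝ :=
  {t | t ∈ Set.Icc g.lo g.hi ∧
    ∀ i, g.Atil i n * t ≤ g.d i - ∑ m ∈ Finset.univ.erase n, g.Atil i m * β m}

/-- The bids `(t, β_{-n})`. -/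
def setBid (β : Vec N) (n : Fin N) (t : ℝ) : Vec N :=
  WithLp.toLp 2 (Function.update (⇑β) n t)

/-- `K` consists of the bids with `β_n ∈ K_n(β_{-n})` for all `n`. -/
theorem mem_K_iff (hN : 0 < N) (β : Vec N) : β ∈ g.K ↔ ∀ n, β n ∈ g.Kn n β := by
  have key : ∀ n i, (g.Atil i n * β n ≤ g.d i - ∑ m ∈ Finset.univ.erase n, g.Atil i m * β m)
      ↔ (g.Atil *ᵥ β) i ≤ g.d i := by
    intro n i
    have : (g.Atil *ᵥ β) i = g.Atil i n * β n + ∑ m ∈ Finset.univ.erase n, g.Atil i m * β m := by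
      rw [Finset.add_sum_erase _ (fun m => g.Atil i m * β m) (Finset.mem_univ n)]
      rfl
    rw [this, le_sub_iff_add_le]
  constructor
  · rintro ⟨h1, h2⟩ n
    exact ⟨h1 n, fun i => (key n i).2 (h2 i)⟩
  · intro h
    exact ⟨fun n => (h n).1, fun i => (key ⟨0, hN⟩ i).1 ((h ⟨0, hN⟩).2 i)⟩

/-- The strictly feasible point: Slater's condition for the coupling constraints. -/
def Slater : Prop := ∃ β ∈ g.Omega, ∀ i, (g.Atil *ᵥ β) i < g.d i

/-- Generalized Nash equilibrium. -/
def IsGNE (β : Vec N) : Prop :=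
  β ∈ g.K ∧ ∀ n, ∀ t ∈ g.Kn n β, g.J n β ≤ g.J n (setBid β n t)

/-- Pseudo-gradient `F(β) = col(∂J̄_n/∂β_n)`. -/
def F (β : Vec N) : Vec N :=
  WithLp.toLp 2 fun n => deriv (fun t => g.J n (setBid β n t)) (β n)

/-- `β` solves the variational inequality `VI(K, F)`. -/
def SolvesVI (β : Vec N) : Prop :=
  β ∈ g.K ∧ ∀ y ∈ g.K, 0 ≤ inner ℝ (y - β) (g.F β)

/-- Variational GNE: a GNE that solves `VI(K, F)`. -/
def IsVGNE (β : Vec N) : Prop := g.IsGNE β ∧ g.SolvesVI β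

/-- `f̂_n(β_n, σ_n)`: the partial derivative `f_n` with the average bid replaced by `σ_n`. -/
def fLoc (n : Fin N) (βn σn : ℝ) : ℝ :=
  ((N : ℝ) - 1) / N * deriv (g.cost n) ((g.r - N * σn) / N + βn)
    + ((N * σn - g.r) * ((N : ℝ) - 2) + N * βn) / (g.α * (N : ℝ) ^ 2)

/-- `F̂(β, σ)`. -/
def FLoc (β σ : Vec N) : Vec N := WithLp.toLp 2 fun n => g.fLoc n (β n) (σ n)

/-- `Ā = blkdiag(Ã_n)` with `Ã_n` the `n`-th column of `Ã`. -/
def Abar : Matrix (Fin N × CIdx N H) (Fin N) ℝ :=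
  Matrix.of fun p m => if p.1 = m then g.Atil p.2 m else 0

/-- `d̄ = col(d_n)`. -/
def dbar : BigVec N H := WithLp.toLp 2 fun p => g.dLoc p.1 p.2

/-! ### Constants -/

def mu (n : Fin N) : ℝ := 2 * g.a n * (((N : ℝ) - 1) / N) + 1 / (g.α * N)

def ell (n : Fin N) : ℝ := -(2 * g.a n * (((N : ℝ) - 1) / N)) + ((N : ℝ) - 2) / (g.α * N)

def gam : ℝ := √(((N : ℝ) - 1) / (g.α * N))

/-- The interval of admissible `κ`. -/
def kappaInterval : Set ℝ :=
  Set.Ioo (⨆ n, (√(g.mu n) - g.gam) ^ 2) (⨅ n, (√(g.mu n) + g.gam) ^ 2)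

def epsUpper (κ : ℝ) (n : Fin N) : ℝ :=
  -√((g.mu n - κ) ^ 2 + (g.ell n - κ) ^ 2) + κ + g.mu n

def epsLower (κ : ℝ) (n : Fin N) : ℝ :=
  g.mu n ^ 2 + g.ell n ^ 2 + 2 * κ ^ 2
    + √((g.mu n + g.ell n) ^ 2 * (g.mu n - g.ell n) ^ 2 + 4 * (κ ^ 2 - g.mu n * g.ell n) ^ 2)

/-- The cocoercivity constant `ε̃`. -/
def epsTil (κ : ℝ) : ℝ := (⨅ n, g.epsUpper κ n) / (⨆ n, g.epsLower κ n)

end Network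

/-! ### Communication graph and algorithm -/

/-- A connected undirected graph on `Fin N` with positive link weights `w n m`; `w n m = 0`
when `{n, m}` is not a link. -/
structure CommGraph (N : ℕ) where
  graph : SimpleGraph (Fin N)
  w : Fin N → Fin N → ℝ
  w_symm : ∀ n m, w n m = w m n
  w_pos : ∀ n m, graph.Adj n m → 0 < w n m
  w_zero : ∀ n m, ¬ graph.Adj n m → w n m = 0
  connected : graph.Connected

/-- The weighted Laplacian of the communication graph. -/
def CommGraph.L {N : ℕ} (G : CommGraph N) : Matrix (Fin N) (Fin N) ℝ :=
  Matrix.diagonal (fun n => ∑ m, G.w n m) - Matrix.of G.w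

/-- `L_λ = L ⊗ I_M`. -/
def CommGraph.Llam {N : ℕ} (G : CommGraph N) (H : ℕ) :
    Matrix (Fin N × CIdx N H) (Fin N × CIdx N H) ℝ :=
  G.L ⊗ₖ (1 : Matrix (CIdx N H) (CIdx N H) ℝ)

/-- Positive step sizes. -/
structure StepSizes (N : ℕ) where
  τ : Fin N → ℝ
  υ : Fin N → ℝ
  ρ : Fin N → ℝ
  δ : Fin N → ℝ
  η : Fin N → ℝ
  τ_pos : ∀ n, 0 < τ n
  υ_pos : ∀ n, 0 < υ n
  ρ_pos : ∀ n, 0 < ρ n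
  δ_pos : ∀ n, 0 < δ n
  η_pos : ∀ n, 0 < η n

/-- `ω = (β, ψ, σ, z, λ)`. -/
abbrev State (N H : ℕ) : Type := Vec N × Vec N × Vec N × BigVec N H × BigVec N H

section Algorithm

variable {N H : ℕ} (g : Network N H) (G : CommGraph N) (κ : ℝ) (s : StepSizes N)

/-- `ε = min{ε̃, 1/λ_max(L)}`. -/
def eps : ℝ := min (g.epsTil κ) (1 / lamMax G.L)

/-- The three step size conditions. -/
structure StepConditions : Prop where
  τ_lt : ∀ n, s.τ n < 2 * eps g G κ
  υ_lt : ∀ n, s.υ n < 2 * eps g G κ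
  δ_lt : ∀ n, s.δ n < 2 * eps g G κ
  ρ_inv : ∀ n, lamMax G.L ^ 2 * (1 / (⨆ m, s.υ m) - 1 / (2 * eps g G κ))⁻¹
      + 1 / (2 * eps g G κ) < (s.ρ n)⁻¹
  η_inv : ∀ n, sigmaMax g.Abar ^ 2 * (1 / (⨆ m, s.τ m) - 1 / (2 * eps g G κ))⁻¹
      + lamMax G.L ^ 2 * (1 / (⨆ m, s.δ m) - 1 / (2 * eps g G κ))⁻¹
      + 1 / (2 * eps g G κ) < (s.η n)⁻¹

/-- The sequences are generated by the fully distributed algorithm. Sums over the neighbours of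
`n` are written as sums over all `m`, since `w n m = 0` for non-neighbours. -/
structure IsRun (β ψ σ : ℕ → Vec N) (z lam : ℕ → BigVec N H) : Prop where
  β_init : β 0 ∈ g.Omega
  lam_init : ∀ p, 0 ≤ lam 0 p
  β_step : ∀ k n, β (k + 1) n = proj (Set.Icc g.lo g.hi)
    (β k n - s.τ n * (g.fLoc n (β k n) (σ k n) + ∑ i, g.Atil i n * lam k (n, i)))
  ψ_step : ∀ k n, ψ (k + 1) n = ψ k n + s.υ n * ∑ m, G.w n m * (σ k n - σ k m)
  σ_step : ∀ k n, σ (k + 1) n = σ k n + s.ρ n * (κ * (β k n - σ k n)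
    - ∑ m, G.w n m * (2 * (ψ (k + 1) n - ψ (k + 1) m) - (ψ k n - ψ k m)))
  z_step : ∀ k n, block (z (k + 1)) n = block (z k) n
    + s.δ n • ∑ m, G.w n m • (block (lam k) n - block (lam k) m)
  lam_step : ∀ k n, block (lam (k + 1)) n = proj {v : CVec N H | ∀ i, 0 ≤ v i}
    (block (lam k) n - s.η n • (∑ m, G.w n m • (block (lam k) n - block (lam k) m)
      + g.dLoc n + (β k n - 2 * β (k + 1) n) • WithLp.toLp 2 (fun i => g.Atil i n)
      + ∑ m, G.w n m • ((2 : ℝ) • (block (z (k + 1)) n - block (z (k + 1)) m)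
          - (block (z k) n - block (z k) m))))

/-- The single-valued operator `𝒜`. -/
def opA : State N H → State N H
  | (β, _, σ, _, lam) =>
    (g.FLoc β σ, 0, κ • (σ - β), 0, g.dbar + Matrix.toEuclideanLin (G.Llam H) lam)

/-- The set-valued operator `ℬ`. -/
def opB : State N H → Set (State N H)
  | (β, ψ, σ, z, lam) =>
    {u | ∃ v ∈ normalCone g.Omega β,
      ∃ y ∈ normalCone {lam' : BigVec N H | ∀ p, 0 ≤ lam' p} lam,
      u = (v + Matrix.toEuclideanLin g.Abarᵀ lam,
           -Matrix.toEuclideanLin G.L σ,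
           Matrix.toEuclideanLin G.L ψ,
           -Matrix.toEuclideanLin (G.Llam H) lam,
           y - Matrix.toEuclideanLin g.Abar β + Matrix.toEuclideanLin (G.Llam H) z)}

/-- `0 ∈ 𝒜(ω) + ℬ(ω)`. -/
def IsZeroAB (ω : State N H) : Prop := 0 ∈ {opA g G κ ω} + opB g G ω

end Algorithm

end AggGame

end

open AggGame

/-! The algorithm is a forward-backward iteration in disguise: one step says that `Φ (ω' - ω) + 𝒜 ω
+ ℬ ω'` contains `0`, where the symmetric preconditioner `Φ` has the inverse step sizes on its
diagonal. Its off-diagonal blocks are chosen to cancel or double the blocks of the skew linear part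
of `ℬ`, which makes the implicit step explicit and distributed (`IsRun.variational`). Convergence
(`forwardBackward_tendsto`) needs `𝒜` to be `ε`-cocoercive and `Φ` to exceed `1/(2ε)`. Then `⟨Φ (ω -
p), ω - p⟩` decreases along the iterates for every zero `p`, the increments tend to zero, any
cluster point is a zero, and Fejér monotonicity at that point gives full convergence. Cocoercivity
(`algSmooth_cocoercive`) splits into the Laplacian, with constant `1/λ_max(L)`, and one 2×2 map `(b,
s) ↦ (μ b + ℓ s, κ (s - b))` per aggregator. Since `μ + ℓ = γ²`, the symmetric part of the latter is
positive definite exactly when `√μ`, `√κ`, `γ` satisfy the strict triangle inequalities, which is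
the condition on `κ`. The bound on `Φ` (`lt_inner_algPrecond_self`) follows from the step size
conditions by splitting the cross terms with Young's inequality. A zero exists (`exists_solvesKKT`):
`F` is strongly monotone, so `VI(K, F)` has a solution; Slater's condition yields multipliers; the
blocks `ψ` and `z` come from solving Laplacian equations with zero-sum right-hand sides. Conversely,
at a zero the estimates `σ_n` equal the average bid and the `λ_n` coincide, so summing the dual
blocks recovers the KKT system of `VI(K, F)` (`SolvesKKT.solvesVI`). Its solutions are equilibria
because each cost is convex in the own bid. -/

noncomputable section

namespace AggGame

set_option linter.unusedSectionVars false

/-! ### Preconditioned forward-backward iteration. -/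

section ForwardBackward

variable {E : Type*} [NormedAddCommGroup E] [InnerProductSpace ℝ E] [FiniteDimensional ℝ E]

/-- A quadratic form that strictly dominates a multiple of the squared norm does so with a margin. -/
theorem exists_margin_of_quadratic_pos (Φ : E →ₗ[ℝ] E) (h : ℝ)
    (hpos : ∀ x, x ≠ 0 → h * ‖x‖ ^ 2 < inner ℝ (Φ x) x) :
    ∃ c > 0, ∀ x, h * ‖x‖ ^ 2 + c * ‖x‖ ^ 2 ≤ inner ℝ (Φ x) x := by
  have hΦc : Continuous Φ := Φ.continuous_of_finiteDimensional
  have hcont : Continuous fun x => inner ℝ (Φ x) x := hΦc.inner continuous_id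
  by_cases hne : (Metric.sphere (0 : E) 1).Nonempty
  -- The margin is the minimum of the Rayleigh quotient over the compact unit sphere, minus `h`.
  · obtain ⟨x₀, hx₀, hmin⟩ := (isCompact_sphere (0 : E) 1).exists_isMinOn hne hcont.continuousOn
    have hn : ‖x₀‖ = 1 := by simpa using hx₀
    have hx0 : x₀ ≠ 0 := by
      rintro rfl
      simp at hn
    refine ⟨inner ℝ (Φ x₀) x₀ - h, ?_, fun x => ?_⟩
    · have := hpos x₀ hx0
      rw [hn] at this
      linarith
    · by_cases hx : x = 0
      · simp [hx]
      · have hxn : 0 < ‖x‖ := norm_pos_iff.2 hx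
        have hmem : (‖x‖⁻¹ • x) ∈ Metric.sphere (0 : E) 1 := by
          simp [norm_smul, hxn.ne']
        have := hmin hmem
        simp only [Set.mem_ofPred_eq, map_smul, inner_smul_left, inner_smul_right] at this
        simp only [conj_trivial] at this
        have h2 : inner ℝ (Φ x₀) x₀ * ‖x‖ ^ 2 ≤ inner ℝ (Φ x) x := by
          calc inner ℝ (Φ x₀) x₀ * ‖x‖ ^ 2 ≤ ‖x‖⁻¹ * (‖x‖⁻¹ * inner ℝ (Φ x) x) * ‖x‖ ^ 2 := by
                gcongr
            _ = inner ℝ (Φ x) x := by field_simp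
        linarith
  -- An empty unit sphere means the space is trivial, so any margin works.
  · refine ⟨1, one_pos, fun x => ?_⟩
    have hx : x = 0 := by
      by_contra hx
      refine hne ⟨‖x‖⁻¹ • x, ?_⟩
      simp [norm_smul, norm_ne_zero_iff.2 hx]
    simp [hx]

omit [FiniteDimensional ℝ E] in
/-- One step of the preconditioned forward-backward iteration is strictly Fejér monotone. -/
theorem forwardBackward_step_le (A : E → E) (Q Φ : E →ₗ[ℝ] E)
    (hQ : ∀ x, inner ℝ (Q x) x = 0) (hΦ : ∀ x y, inner ℝ (Φ x) y = inner ℝ x (Φ y))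
    {ε : ℝ} (hε : 0 < ε)
    {x x' p : E} (hA : ε * ‖A x - A p‖ ^ 2 ≤ inner ℝ (A x - A p) (x - p))
    (hp : 0 ≤ inner ℝ (A p + Q p) (x' - p))
    (hx : 0 ≤ inner ℝ (Φ (x' - x) + A x + Q x') (p - x')) :
    inner ℝ (Φ (x' - p)) (x' - p) + (inner ℝ (Φ (x' - x)) (x' - x) - 1 / (2 * ε) * ‖x' - x‖ ^ 2)
      ≤ inner ℝ (Φ (x - p)) (x - p) := by
  have hskew := hQ (x' - p)
  -- With `e = x - p`, `t = x' - x`, `a = A x - A p`, adding `hp` and `hx` and cancelling `Q` by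
  -- skewness leaves `⟨Φ t, e + t⟩ + ⟨a, e + t⟩ ≤ 0`.
  obtain ⟨e, rfl⟩ : ∃ e, x = p + e := ⟨x - p, by abel⟩
  obtain ⟨t, rfl⟩ : ∃ t, x' = p + e + t := ⟨x' - (p + e), by abel⟩
  generalize hp' : A p = P at *
  obtain ⟨a, ha⟩ : ∃ a, A (p + e) = P + a := ⟨A (p + e) - P, by abel⟩
  rw [ha] at hA hx
  have e1 : p - (p + e + t) = -(e + t) := by abel
  have e2 : p + e + t - p = e + t := by abel
  have e3 : p + e + t - (p + e) = t := by abel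
  have e4 : p + e - p = e := by abel
  have e5 : P + a - P = a := by abel
  rw [e2] at hskew hp
  rw [e1, e3] at hx
  rw [e4, e5] at hA
  rw [e2, e3, e4]
  have e6 : Q (p + e + t) = Q p + Q (e + t) := by rw [← map_add, add_assoc]
  rw [e6] at hx
  simp only [inner_neg_right, inner_add_left] at hx hp
  simp only [map_add, inner_add_left, inner_add_right] at *
  have hsym : inner ℝ (Φ e) t = inner ℝ (Φ t) e := by rw [hΦ, real_inner_comm]
  -- Young's inequality weighted so that `ε ‖a‖²` is absorbed by the cocoercivity bound on `⟨a, e⟩`.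
  have hy : -(inner ℝ a t) ≤ ε * ‖a‖ ^ 2 + 1 / (4 * ε) * ‖t‖ ^ 2 := by
    have h1 : 0 ≤ ‖(2 * ε) • a + t‖ ^ 2 := by positivity
    rw [norm_add_sq_real, norm_smul, inner_smul_left, mul_pow] at h1
    simp only [Real.norm_eq_abs, sq_abs, conj_trivial] at h1
    have h2 : 0 ≤ ((2 * ε) ^ 2 * ‖a‖ ^ 2 + 2 * (2 * ε * inner ℝ a t) + ‖t‖ ^ 2) / (4 * ε) := by
      positivity
    have h3 : ((2 * ε) ^ 2 * ‖a‖ ^ 2 + 2 * (2 * ε * inner ℝ a t) + ‖t‖ ^ 2) / (4 * ε)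
        = ε * ‖a‖ ^ 2 + inner ℝ a t + 1 / (4 * ε) * ‖t‖ ^ 2 := by
      field_simp
      ring
    linarith
  have h4 : 1 / (2 * ε) * ‖t‖ ^ 2 = 2 * (1 / (4 * ε) * ‖t‖ ^ 2) := by
    field_simp
    ring
  rw [h4]
  linarith

/-- Convergence of the preconditioned forward-backward iteration for a cocoercive map `A`, the
normal cone of a closed set `S` and a skew linear map `Q`. -/
theorem forwardBackward_tendsto {S : Set E} (hS : IsClosed S) (A : E → E) (hAc : Continuous A)
    (Q Φ : E →ₗ[ℝ] E)
    (hQ : ∀ x, inner ℝ (Q x) x = 0) (hΦ : ∀ x y, inner ℝ (Φ x) y = inner ℝ x (Φ y))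
    {ε : ℝ} (hε : 0 < ε)
    (hA : ∀ x y, ε * ‖A x - A y‖ ^ 2 ≤ inner ℝ (A x - A y) (x - y))
    (hpos : ∀ x, x ≠ 0 → 1 / (2 * ε) * ‖x‖ ^ 2 < inner ℝ (Φ x) x)
    {p : E} (hpS : p ∈ S) (hp : ∀ y ∈ S, 0 ≤ inner ℝ (A p + Q p) (y - p))
    (x : ℕ → E) (hxS : ∀ k, x (k + 1) ∈ S)
    (hx : ∀ k, ∀ y ∈ S,
      0 ≤ inner ℝ (Φ (x (k + 1) - x k) + A (x k) + Q (x (k + 1))) (y - x (k + 1))) :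
    ∃ q ∈ S, (∀ y ∈ S, 0 ≤ inner ℝ (A q + Q q) (y - q)) ∧ Tendsto x atTop (𝓝 q) := by
  obtain ⟨c, hc, hmarg⟩ := exists_margin_of_quadratic_pos Φ _ hpos
  have hΦc : Continuous Φ := Φ.continuous_of_finiteDimensional
  have hQc : Continuous Q := Q.continuous_of_finiteDimensional
  have hε' : 0 < 1 / (2 * ε) := by positivity
  set V : E → ℝ := fun u => inner ℝ (Φ u) u with hV
  have hVc : Continuous V := hΦc.inner continuous_id
  have hVge : ∀ u, c * ‖u‖ ^ 2 ≤ V u := fun u => by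
    have := hmarg u
    have h2 : 0 ≤ 1 / (2 * ε) * ‖u‖ ^ 2 := by positivity
    simp only [hV]
    linarith
  have hdec : ∀ q ∈ S, (∀ y ∈ S, 0 ≤ inner ℝ (A q + Q q) (y - q)) → ∀ k,
      V (x (k + 1) - q) + c * ‖x (k + 1) - x k‖ ^ 2 ≤ V (x k - q) := by
    intro q hqS hq k
    have h1 := forwardBackward_step_le A Q Φ hQ hΦ hε (hA (x k) q) (hq _ (hxS k)) (hx k q hqS)
    have h2 := hmarg (x (k + 1) - x k)
    simp only [hV]
    linarith
  have hanti : ∀ q ∈ S, (∀ y ∈ S, 0 ≤ inner ℝ (A q + Q q) (y - q)) →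
      Antitone fun k => V (x k - q) := fun q hqS hq => antitone_nat_of_succ_le fun k => by
    have := hdec q hqS hq k
    have h2 : 0 ≤ c * ‖x (k + 1) - x k‖ ^ 2 := by positivity
    linarith
  have hVnn : ∀ u, 0 ≤ V u := fun u => le_trans (by positivity) (hVge u)
  have hbdd : BddBelow (Set.range fun k => V (x k - p)) := ⟨0, by
    rintro _ ⟨k, rfl⟩
    exact hVnn _⟩
  have hlim := tendsto_atTop_ciInf (hanti p hpS hp) hbdd
  -- The energy converges, so its decrements, which dominate `c ‖x (k+1) - x k‖²`, tend to zero.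
  have hdiff : Tendsto (fun k => x (k + 1) - x k) atTop (𝓝 0) := by
    have h1 : Tendsto (fun k => V (x k - p) - V (x (k + 1) - p)) atTop (𝓝 0) := by
      have := hlim.sub ((tendsto_add_atTop_iff_nat 1).2 hlim)
      simpa using this
    have h2 : Tendsto (fun k => ‖x (k + 1) - x k‖ ^ 2) atTop (𝓝 0) := by
      have h3 : Tendsto (fun k => c⁻¹ * (V (x k - p) - V (x (k + 1) - p))) atTop (𝓝 0) := by
        simpa using h1.const_mul c⁻¹
      refine squeeze_zero (fun k => by positivity) (fun k => ?_) h3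
      rw [le_inv_mul_iff₀ hc]
      have := hdec p hpS hp k
      linarith
    rw [tendsto_zero_iff_norm_tendsto_zero]
    have := h2.sqrt
    simpa [Real.sqrt_sq] using this
  have hbd : Bornology.IsBounded (Set.range x) := by
    refine (Metric.isBounded_closedBall (x := p) (r := √(c⁻¹ * V (x 0 - p)))).subset ?_
    rintro _ ⟨k, rfl⟩
    rw [Metric.mem_closedBall, dist_eq_norm]
    refine Real.le_sqrt_of_sq_le ?_
    rw [le_inv_mul_iff₀ hc]
    exact (hVge _).trans (hanti p hpS hp (Nat.zero_le k))
  -- Since increments vanish, `x (φ k)` and `x (φ k + 1)` share the limit `q`, and the inequality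
  -- `hx` passes to the limit.
  obtain ⟨q, -, φ, hφ, hq⟩ := tendsto_subseq_of_bounded hbd (fun k => Set.mem_range_self k)
  have hq' : Tendsto (fun k => x (φ k + 1)) atTop (𝓝 q) := by
    have := hq.add (hdiff.comp hφ.tendsto_atTop)
    simpa using this
  have hqS : q ∈ S := hS.mem_of_tendsto hq' (Eventually.of_forall fun k => hxS _)
  have hqsol : ∀ y ∈ S, 0 ≤ inner ℝ (A q + Q q) (y - q) := by
    intro y hy
    have h1 : Tendsto (fun k => inner ℝ (Φ (x (φ k + 1) - x (φ k)) + A (x (φ k))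
        + Q (x (φ k + 1))) (y - x (φ k + 1))) atTop (𝓝 (inner ℝ (Φ (q - q) + A q + Q q) (y - q))) :=
      Tendsto.inner ((((hΦc.tendsto _).comp (hq'.sub hq)).add ((hAc.tendsto _).comp hq)).add
        ((hQc.tendsto _).comp hq')) (tendsto_const_nhds.sub hq')
    have h2 := ge_of_tendsto' h1 fun k => hx (φ k) y hy
    simpa using h2
  refine ⟨q, hqS, hqsol, ?_⟩
  have hbddq : BddBelow (Set.range fun k => V (x k - q)) := ⟨0, by
    rintro _ ⟨k, rfl⟩
    exact hVnn _⟩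
  have hlimq := tendsto_atTop_ciInf (hanti q hqS hqsol) hbddq
  have hsub : Tendsto (fun k => V (x (φ k) - q)) atTop (𝓝 0) := by
    have h1 := (hVc.tendsto (q - q)).comp (hq.sub (tendsto_const_nhds (x := q)))
    have h0 : V (q - q) = 0 := by simp [hV]
    rw [h0] at h1
    exact h1
  -- The energy relative to `q` is monotone, hence convergent, and a subsequence tends to zero.
  have hzero := tendsto_nhds_unique (hlimq.comp hφ.tendsto_atTop) hsub
  rw [hzero] at hlimq
  rw [tendsto_iff_norm_sub_tendsto_zero]
  have h2 : Tendsto (fun k => ‖x k - q‖ ^ 2) atTop (𝓝 0) := by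
    have h3 : Tendsto (fun k => c⁻¹ * V (x k - q)) atTop (𝓝 0) := by
      simpa using hlimq.const_mul c⁻¹
    refine squeeze_zero (fun k => by positivity) (fun k => ?_) h3
    rw [le_inv_mul_iff₀ hc]
    exact hVge _
  simpa [Real.sqrt_sq] using h2.sqrt

end ForwardBackward

/-! ### Projections and solvability of strongly monotone variational inequalities. -/

section VariationalInequality

variable {E : Type*} [NormedAddCommGroup E] [InnerProductSpace ℝ E] [FiniteDimensional ℝ E]

/-- Variational characterization of the projection on a closed convex set. -/
theorem inner_sub_proj_nonpos {S : Set E} (hS : IsClosed S) (hconv : Convex ℝ S)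
    (hne : S.Nonempty) (x : E) {y : E} (hy : y ∈ S) :
    inner ℝ (x - proj S x) (y - proj S x) ≤ 0 := by
  obtain ⟨hmem, hmin⟩ := proj_spec hS hne x
  have hinf : ‖x - proj S x‖ = ⨅ w : S, ‖x - w‖ := by
    have : Nonempty S := hne.to_subtype
    refine le_antisymm (le_ciInf fun w => ?_) ?_
    · rw [norm_sub_rev, norm_sub_rev x]
      exact hmin w w.2
    · exact ciInf_le (f := fun w : S => ‖x - w‖) ⟨0, by
        rintro _ ⟨w, rfl⟩
        exact norm_nonneg _⟩ ⟨_, hmem⟩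
  exact (norm_eq_iInf_iff_real_inner_le_zero hconv hmem).1 hinf y hy

/-- Adding the variational inequalities of the two projections gives firm nonexpansiveness `h3`;
Cauchy–Schwarz does the rest. -/
theorem norm_proj_sub_proj_le {S : Set E} (hS : IsClosed S) (hconv : Convex ℝ S)
    (hne : S.Nonempty) (x y : E) : ‖proj S x - proj S y‖ ≤ ‖x - y‖ := by
  have h1 := inner_sub_proj_nonpos hS hconv hne x (proj_spec hS hne y).1
  have h2 := inner_sub_proj_nonpos hS hconv hne y (proj_spec hS hne x).1
  set u := proj S x
  set v := proj S y
  have h3 : ‖u - v‖ ^ 2 ≤ inner ℝ (x - y) (u - v) := by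
    have e : inner ℝ (x - y) (u - v) - ‖u - v‖ ^ 2
        = -inner ℝ (x - u) (v - u) - inner ℝ (y - v) (u - v) := by
      rw [← real_inner_self_eq_norm_sq]
      simp only [inner_sub_left, inner_sub_right]
      ring
    linarith
  have h4 := real_inner_le_norm (x - y) (u - v)
  by_contra! h
  have h5 : ‖x - y‖ * ‖u - v‖ < ‖u - v‖ * ‖u - v‖ :=
    mul_lt_mul_of_pos_right h (lt_of_le_of_lt (norm_nonneg _) h)
  nlinarith

/-- A strongly monotone Lipschitz variational inequality on a closed convex set is solvable. -/
theorem exists_solution_of_stronglyMonotone {S : Set E} (hS : IsClosed S) (hconv : Convex ℝ S)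
    (hne : S.Nonempty) (F : E → E) {m l : ℝ} (hm : 0 < m)
    (hmono : ∀ x y, m * ‖x - y‖ ^ 2 ≤ inner ℝ (F x - F y) (x - y))
    (hlip : ∀ x y, ‖F x - F y‖ ≤ l * ‖x - y‖) :
    ∃ p ∈ S, ∀ y ∈ S, 0 ≤ inner ℝ (F p) (y - p) := by
  -- Enlarging the Lipschitz constant past `m` makes it positive and keeps `1 - m²/l'²` positive
  -- under the root.
  obtain ⟨l', hll, hml⟩ : ∃ l', l ≤ l' ∧ m < l' := ⟨max l (m + 1), le_max_left _ _,
    lt_of_lt_of_le (by linarith) (le_max_right _ _)⟩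
  have hl' : 0 < l' := hm.trans hml
  -- This step minimizes `1 - 2 t m + t² l'²`, the squared contraction factor of the projected step
  -- `T`; solutions are the fixed points of `T`.
  set t := m / l' ^ 2 with ht
  have htpos : 0 < t := by positivity
  set κ := √(1 - m ^ 2 / l' ^ 2) with hκ
  have hle1 : m ^ 2 / l' ^ 2 < 1 := by
    rw [div_lt_one (by positivity)]
    exact pow_lt_pow_left₀ hml hm.le two_ne_zero
  have hκ1 : κ < 1 := by
    rw [hκ, Real.sqrt_lt' one_pos]
    have : 0 < m ^ 2 / l' ^ 2 := by positivity
    linarith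
  set T : E → E := fun x => proj S (x - t • F x) with hT
  have hcontr : ∀ x y, ‖T x - T y‖ ≤ κ * ‖x - y‖ := by
    intro x y
    refine (norm_proj_sub_proj_le hS hconv hne _ _).trans ?_
    rw [← Real.sqrt_sq (norm_nonneg (x - y)), hκ, ← Real.sqrt_mul (by linarith)]
    refine Real.le_sqrt_of_sq_le ?_
    have e : x - t • F x - (y - t • F y) = (x - y) - t • (F x - F y) := by
      rw [smul_sub]; abel
    rw [e, norm_sub_sq_real, norm_smul, inner_smul_right, Real.norm_eq_abs, abs_of_pos htpos,
      mul_pow, real_inner_comm]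
    have h1 := hmono x y
    have h2 : ‖F x - F y‖ ^ 2 ≤ l' ^ 2 * ‖x - y‖ ^ 2 := by
      rw [← mul_pow]
      exact pow_le_pow_left₀ (norm_nonneg _)
        ((hlip x y).trans (mul_le_mul_of_nonneg_right hll (norm_nonneg _))) 2
    have h3 : t ^ 2 * ‖F x - F y‖ ^ 2 ≤ t ^ 2 * (l' ^ 2 * ‖x - y‖ ^ 2) := by gcongr
    have h4 : t * (m * ‖x - y‖ ^ 2) ≤ t * inner ℝ (F x - F y) (x - y) := by gcongr
    have h5 : t ^ 2 * (l' ^ 2 * ‖x - y‖ ^ 2) = m ^ 2 / l' ^ 2 * ‖x - y‖ ^ 2 := by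
      rw [ht]; field_simp
    have h6 : t * (m * ‖x - y‖ ^ 2) = m ^ 2 / l' ^ 2 * ‖x - y‖ ^ 2 := by
      rw [ht]; field_simp
    linarith
  have hcw : ContractingWith (Real.toNNReal κ) T := by
    refine ⟨?_, LipschitzWith.of_dist_le_mul fun x y => ?_⟩
    · rwa [Real.toNNReal_lt_one]
    · rw [dist_eq_norm, dist_eq_norm, Real.coe_toNNReal _ (Real.sqrt_nonneg _)]
      exact hcontr x y
  have : Nonempty E := ⟨0⟩
  have hfix : T (hcw.fixedPoint T) = hcw.fixedPoint T := hcw.fixedPoint_isFixedPt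
  set p := hcw.fixedPoint T
  have hpS : p ∈ S := by
    rw [← hfix]
    exact (proj_spec hS hne _).1
  refine ⟨p, hpS, fun y hy => ?_⟩
  have h := inner_sub_proj_nonpos hS hconv hne (p - t • F p) hy
  have hfix' : proj S (p - t • F p) = p := hfix
  rw [hfix'] at h
  have e : p - t • F p - p = -(t • F p) := by abel
  rw [e, inner_neg_left, inner_smul_left] at h
  simp only [conj_trivial] at h
  have h7 : 0 ≤ t * inner ℝ (F p) (y - p) := by linarith
  exact nonneg_of_mul_nonneg_right h7 htpos

end VariationalInequality

/-! ### Lagrange multipliers by separation. -/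

section Multipliers

/-- Lagrange multipliers under Slater's condition: for a linear objective `f` minimized over a
convex set subject to finitely many affine inequalities. -/
theorem exists_multiplier_of_slater {E ι : Type*} [Fintype ι] [AddCommGroup E] [Module ℝ E]
    {S : Set E} (hconv : Convex ℝ S) (B : E →ₗ[ℝ] (ι → ℝ)) (d : ι → ℝ) (f : E →ₗ[ℝ] ℝ) {p : E}
    (hmin : ∀ y ∈ S, (∀ i, B y i ≤ d i) → f p ≤ f y)
    (hsl : ∃ y ∈ S, ∀ i, B y i < d i) :
    ∃ lam : ι → ℝ, (∀ i, 0 ≤ lam i) ∧ ∀ y ∈ S, f p ≤ f y + ∑ i, lam i * (B y i - d i) := by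
  classical
  -- Pairs strictly above an attainable (constraint excess, objective excess). Strict inequalities
  -- make `C` open, so that it is separated from `0` by a functional strictly positive on `C`.
  set C : Set ((ι → ℝ) × ℝ) := {u | ∃ y ∈ S, (∀ i, B y i - d i < u.1 i) ∧ f y - f p < u.2} with hC
  have hCconv : Convex ℝ C := by
    rintro u ⟨y, hy, hu1, hu2⟩ v ⟨y', hy', hv1, hv2⟩ a b ha hb hab
    refine ⟨a • y + b • y', hconv hy hy' ha hb hab, fun i => ?_, ?_⟩
    · have e : B (a • y + b • y') i - d i = a * (B y i - d i) + b * (B y' i - d i) := by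
        simp only [map_add, map_smul, Pi.add_apply, Pi.smul_apply, smul_eq_mul]
        linear_combination d i * hab
      rw [e]
      simp only [Prod.fst_add, Prod.smul_fst, Pi.add_apply, Pi.smul_apply, smul_eq_mul]
      -- A positive weight preserves strictness; with weight zero the other point supplies it.
      rcases ha.eq_or_lt with rfl | ha'
      · have : b = 1 := by linarith
        subst this
        simpa using hv1 i
      · have h1 := mul_lt_mul_of_pos_left (hu1 i) ha'
        have h2 := mul_le_mul_of_nonneg_left (hv1 i).le hb
        linarith
    · have e : f (a • y + b • y') - f p = a * (f y - f p) + b * (f y' - f p) := by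
        simp only [map_add, map_smul, smul_eq_mul]
        linear_combination f p * hab
      rw [e]
      simp only [Prod.snd_add, Prod.smul_snd, smul_eq_mul]
      rcases ha.eq_or_lt with rfl | ha'
      · have : b = 1 := by linarith
        subst this
        simpa using hv2
      · have h1 := mul_lt_mul_of_pos_left hu2 ha'
        have h2 := mul_le_mul_of_nonneg_left hv2.le hb
        linarith
  have hCopen : IsOpen C := by
    have : C = ⋃ y ∈ S, ({u : (ι → ℝ) × ℝ | (∀ i, B y i - d i < u.1 i) ∧ f y - f p < u.2}) := by
      ext u; simp [hC, and_left_comm]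
    rw [this]
    refine isOpen_biUnion fun y _ => ?_
    refine IsOpen.inter ?_ (isOpen_lt continuous_const continuous_snd)
    have : {u : (ι → ℝ) × ℝ | ∀ i, B y i - d i < u.1 i} = ⋂ i, {u | B y i - d i < u.1 i} := by
      ext u; simp
    change IsOpen {u : (ι → ℝ) × ℝ | ∀ i, B y i - d i < u.1 i}
    rw [this]
    exact isOpen_iInter_of_finite fun i =>
      isOpen_lt continuous_const ((continuous_apply i).comp continuous_fst)
  have h0 : (0 : (ι → ℝ) × ℝ) ∉ C := by
    rintro ⟨y, hy, h1, h2⟩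
    have := hmin y hy fun i => by
      have := h1 i
      simp only [Prod.fst_zero, Pi.zero_apply] at this
      linarith
    simp only [Prod.snd_zero] at h2
    linarith
  obtain ⟨F, hF⟩ := geometric_hahn_banach_point_open hCconv hCopen h0
  rw [map_zero] at hF
  set s := F (0, 1) with hs
  set l : ι → ℝ := fun i => F (Pi.single i 1, 0) with hl
  have hrep : ∀ u, F u = ∑ i, l i * u.1 i + s * u.2 := by
    rintro ⟨u, t⟩
    have e : ((u, t) : (ι → ℝ) × ℝ) = ∑ i, u i • ((Pi.single i (1 : ℝ), (0 : ℝ)) : (ι → ℝ) × ℝ)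
        + t • ((0 : ι → ℝ), (1 : ℝ)) := by
      refine Prod.ext ?_ ?_
      · ext j
        simp [Prod.fst_sum, Finset.sum_apply, Pi.single_apply]
      · simp [Prod.snd_sum]
    rw [e, map_add, map_sum]
    simp only [map_smul, smul_eq_mul, ← hs]
    have hsum : ∑ i, u i * F (Pi.single i 1, 0) = ∑ i, l i * u i :=
      Finset.sum_congr rfl fun i _ => by rw [hl, mul_comm]
    rw [hsum]
    have e1 : (∑ i, u i • ((Pi.single i (1 : ℝ), (0 : ℝ)) : (ι → ℝ) × ℝ)
        + t • ((0 : ι → ℝ), (1 : ℝ))) = (u, t) := e.symm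
    rw [e1]
    ring
  obtain ⟨y₀, hy₀, hsl₀⟩ := hsl
  have hmem : ∀ y ∈ S, ∀ (a : ι → ℝ) (t : ℝ), (∀ i, B y i - d i < a i) → f y - f p < t →
      0 < ∑ i, l i * a i + s * t := fun y hy a t h1 h2 => by
    have := hF (a, t) ⟨y, hy, h1, h2⟩
    rwa [hrep] at this
  have hclosed : ∀ y ∈ S, ∀ (a : ι → ℝ) (t : ℝ), (∀ i, B y i - d i ≤ a i) → f y - f p ≤ t →
      0 ≤ ∑ i, l i * a i + s * t := fun y hy a t h1 h2 => by
    have hc : Tendsto (fun δ : ℝ => ∑ i, l i * (a i + δ) + s * (t + δ)) (𝓝[>] 0)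
        (𝓝 (∑ i, l i * (a i + 0) + s * (t + 0))) := by
      refine tendsto_nhdsWithin_of_tendsto_nhds (Continuous.tendsto ?_ 0)
      fun_prop
    simp only [add_zero] at hc
    refine ge_of_tendsto hc ?_
    filter_upwards [self_mem_nhdsWithin] with δ hδ
    have hδ' : 0 < δ := hδ
    exact (hmem y hy _ _ (fun i => by linarith [h1 i]) (by linarith)).le
  -- The set is stable under adding nonnegative directions, so the functional cannot be negative on
  -- one: a large multiple `R` would outweigh the base value.
  have key : ∀ (v : ι → ℝ) (τ : ℝ), (∀ i, 0 ≤ v i) → 0 ≤ τ → 0 ≤ ∑ i, l i * v i + s * τ := by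
    intro v τ hv hτ
    have hbase : ∀ R : ℝ, 0 ≤ R → 0 ≤ (∑ i, l i * (B y₀ i - d i) + s * (f y₀ - f p))
        + R * (∑ i, l i * v i + s * τ) := by
      intro R hR
      have := hclosed y₀ hy₀ (fun i => B y₀ i - d i + R * v i) (f y₀ - f p + R * τ)
        (fun i => by nlinarith [hv i, mul_nonneg hR (hv i)]) (by nlinarith [mul_nonneg hR hτ])
      have e : ∑ i, l i * (B y₀ i - d i + R * v i) + s * (f y₀ - f p + R * τ)
          = (∑ i, l i * (B y₀ i - d i) + s * (f y₀ - f p)) + R * (∑ i, l i * v i + s * τ) := by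
        simp only [mul_add, Finset.mul_sum, Finset.sum_add_distrib]
        have : ∑ i, l i * (R * v i) = ∑ i, R * (l i * v i) :=
          Finset.sum_congr rfl fun i _ => by ring
        rw [this]
        ring
      rwa [e] at this
    by_contra! hneg
    set b := ∑ i, l i * (B y₀ i - d i) + s * (f y₀ - f p)
    set n := ∑ i, l i * v i + s * τ
    have h1 := hbase ((|b| + 1) / (-n)) (by
      have : 0 < -n := by linarith
      positivity)
    have h2 : (|b| + 1) / (-n) * n = -(|b| + 1) := by
      have : n ≠ 0 := hneg.ne
      field_simp
    rw [h2] at h1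
    have := le_abs_self b
    linarith
  have hlnn : ∀ i, 0 ≤ l i := fun i => by
    have := key (Pi.single i 1) 0 (fun j => by
      by_cases h : j = i
      · subst h; simp
      · simp [h]) le_rfl
    simpa [Pi.single_apply] using this
  have hsnn : 0 ≤ s := by
    have := key 0 1 (fun _ => le_rfl) zero_le_one
    simpa using this
  -- Slater's point rules out a vertical hyperplane: if `s = 0`, the choice `a = 0` over `y₀` would
  -- give a functional value both positive and nonpositive.
  have hspos : 0 < s := by
    refine lt_of_le_of_ne hsnn fun hs0 => ?_
    obtain ⟨a, ha1, ha2⟩ : ∃ a : ι → ℝ, (∀ i, B y₀ i - d i < a i) ∧ ∀ i, a i ≤ 0 :=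
      ⟨fun i => 0, fun i => by linarith [hsl₀ i], fun _ => le_rfl⟩
    have := hmem y₀ hy₀ a (f y₀ - f p + 1) ha1 (by linarith)
    rw [← hs0, zero_mul, add_zero] at this
    have h2 : ∑ i, l i * a i ≤ 0 :=
      Finset.sum_nonpos fun i _ => mul_nonpos_of_nonneg_of_nonpos (hlnn i) (ha2 i)
    linarith
  refine ⟨fun i => l i / s, fun i => div_nonneg (hlnn i) hsnn, fun y hy => ?_⟩
  have := hclosed y hy (fun i => B y i - d i) (f y - f p) (fun _ => le_rfl) le_rfl
  have e : ∑ i, l i / s * (B y i - d i) = (∑ i, l i * (B y i - d i)) / s := by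
    rw [Finset.sum_div]
    exact Finset.sum_congr rfl fun i _ => by ring
  rw [e]
  have h3 : 0 ≤ (∑ i, l i * (B y i - d i) + s * (f y - f p)) / s := div_nonneg this hsnn
  have h4 : (∑ i, l i * (B y i - d i) + s * (f y - f p)) / s
      = (∑ i, l i * (B y i - d i)) / s + (f y - f p) := by
    field_simp
  linarith

end Multipliers

/-! ### Spectral bound for symmetric matrices. -/

section LargestEigenvalue

variable {ι : Type*} [Fintype ι] [DecidableEq ι]

theorem inner_toEuclideanLin_comm {A : Matrix ι ι ℝ} (hA : A.IsHermitian)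
    (x y : EuclideanSpace ℝ ι) :
    inner ℝ (Matrix.toEuclideanLin A x) y = inner ℝ x (Matrix.toEuclideanLin A y) :=
  Matrix.isSymmetric_toEuclideanLin_iff.2 hA x y

/-- A positive semidefinite matrix satisfies `A² ≤ λ_max(A) A`. -/
theorem norm_sq_le_lamMax_mul_inner {A : Matrix ι ι ℝ} (hA : A.IsHermitian)
    (hpos : ∀ x, 0 ≤ inner ℝ (Matrix.toEuclideanLin A x) x) (x : EuclideanSpace ℝ ι) :
    ‖Matrix.toEuclideanLin A x‖ ^ 2 ≤ lamMax A * inner ℝ (Matrix.toEuclideanLin A x) x := by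
  set b := hA.eigenvectorBasis
  have hb : ∀ i, Matrix.toEuclideanLin A (b i) = hA.eigenvalues i • b i := fun i => by
    ext j
    have := congrFun (hA.mulVec_eigenvectorBasis i) j
    simpa [Matrix.toLpLin_apply, b] using this
  have hAb : ∀ i, inner ℝ (Matrix.toEuclideanLin A x) (b i) = hA.eigenvalues i * inner ℝ x (b i) :=
    fun i => by rw [inner_toEuclideanLin_comm hA, hb, inner_smul_right]
  have hnn : ∀ i, 0 ≤ hA.eigenvalues i := fun i => by
    have := hpos (b i)
    rw [hb, inner_smul_left, real_inner_self_eq_norm_sq, b.norm_eq_one] at this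
    simpa using this
  have hle : ∀ i, hA.eigenvalues i ≤ lamMax A := fun i =>
    le_csSup (Matrix.finite_real_spectrum.bddAbove) (hA.eigenvalues_mem_spectrum_real i)
  have e1 : ‖Matrix.toEuclideanLin A x‖ ^ 2 = ∑ i, hA.eigenvalues i ^ 2 * inner ℝ x (b i) ^ 2 := by
    rw [← real_inner_self_eq_norm_sq, ← b.sum_inner_mul_inner]
    refine Finset.sum_congr rfl fun i _ => ?_
    rw [real_inner_comm _ (b i), hAb]
    ring
  have e2 : inner ℝ (Matrix.toEuclideanLin A x) x = ∑ i, hA.eigenvalues i * inner ℝ x (b i) ^ 2 := by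
    rw [← b.sum_inner_mul_inner]
    refine Finset.sum_congr rfl fun i _ => ?_
    rw [real_inner_comm _ (b i), hAb]
    ring
  rw [e1, e2, Finset.mul_sum]
  refine Finset.sum_le_sum fun i _ => ?_
  -- In the eigenbasis the claim is `λ_i² ≤ λ_max λ_i`, which needs `λ_i ≥ 0`.
  have := mul_le_mul_of_nonneg_right (hle i) (mul_nonneg (hnn i) (sq_nonneg (inner ℝ x (b i))))
  nlinarith

end LargestEigenvalue

/-! ### Kernel, range and norm of the graph Laplacian and of `L ⊗ I`. -/

namespace CommGraph

variable {N : ℕ} (G : CommGraph N)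

theorem w_nonneg (n m : Fin N) : 0 ≤ G.w n m := by
  by_cases h : G.graph.Adj n m
  · exact (G.w_pos n m h).le
  · exact (G.w_zero n m h).ge

theorem L_mulVec (x : Fin N → ℝ) (n : Fin N) :
    (G.L *ᵥ x) n = ∑ m, G.w n m * (x n - x m) := by
  rw [L, Matrix.sub_mulVec, Pi.sub_apply, Matrix.mulVec_diagonal]
  simp only [Matrix.mulVec, dotProduct, Matrix.of_apply, mul_sub, Finset.sum_sub_distrib,
    Finset.sum_mul]

theorem L_apply (x : Vec N) (n : Fin N) :
    Matrix.toEuclideanLin G.L x n = ∑ m, G.w n m * (x n - x m) := by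
  rw [Matrix.toLpLin_apply]
  exact G.L_mulVec x n

theorem L_isHermitian : G.L.IsHermitian := by
  ext n m
  simp only [L, Matrix.conjTranspose_apply, Matrix.sub_apply, Matrix.of_apply, star_trivial,
    G.w_symm m n, Matrix.diagonal_apply]
  by_cases h : n = m
  · subst h; rfl
  · simp [h, Ne.symm h]

/-- Symmetrizing the double sum in `n` and `m` by `w_symm` produces the Dirichlet energy. -/
theorem inner_L_self (x : Vec N) :
    inner ℝ (Matrix.toEuclideanLin G.L x) x = 1 / 2 * ∑ n, ∑ m, G.w n m * (x n - x m) ^ 2 := by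
  have e1 : inner ℝ (Matrix.toEuclideanLin G.L x) x
      = ∑ n, ∑ m, G.w n m * (x n - x m) * x n := by
    rw [real_inner_comm, PiLp.inner_apply]
    refine Finset.sum_congr rfl fun n _ => ?_
    rw [G.L_apply, ← Finset.sum_mul]
    simp
  have e2 : ∑ n, ∑ m, G.w n m * (x n - x m) * x n = ∑ n, ∑ m, G.w n m * (x m - x n) * x m := by
    rw [Finset.sum_comm]
    exact Finset.sum_congr rfl fun n _ => Finset.sum_congr rfl fun m _ => by rw [G.w_symm]
  have e3 : ∑ n, ∑ m, G.w n m * (x n - x m) ^ 2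
      = ∑ n, ∑ m, G.w n m * (x n - x m) * x n + ∑ n, ∑ m, G.w n m * (x m - x n) * x m := by
    rw [← Finset.sum_add_distrib]
    refine Finset.sum_congr rfl fun n _ => ?_
    rw [← Finset.sum_add_distrib]
    exact Finset.sum_congr rfl fun m _ => by ring
  rw [e1, e3, ← e2]
  ring

theorem inner_L_self_nonneg (x : Vec N) : 0 ≤ inner ℝ (Matrix.toEuclideanLin G.L x) x := by
  rw [inner_L_self]
  have : 0 ≤ ∑ n, ∑ m, G.w n m * (x n - x m) ^ 2 := Finset.sum_nonneg fun n _ =>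
    Finset.sum_nonneg fun m _ => mul_nonneg (G.w_nonneg n m) (sq_nonneg _)
  linarith

/-- The kernel of the Laplacian of a connected graph consists of the constant vectors. -/
theorem eq_of_L_eq_zero {x : Vec N} (hx : Matrix.toEuclideanLin G.L x = 0) (n m : Fin N) :
    x n = x m := by
  have h0 : ∑ n, ∑ m, G.w n m * (x n - x m) ^ 2 = 0 := by
    have := G.inner_L_self x
    rw [hx, inner_zero_left] at this
    linarith
  have hadj : ∀ n m, G.graph.Adj n m → x n = x m := by
    intro n m h
    -- Zero energy forces equality across each link; the walk induction below spreads it over the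
    -- graph.
    have h1 := (Finset.sum_eq_zero_iff_of_nonneg fun n _ => Finset.sum_nonneg fun m _ =>
      mul_nonneg (G.w_nonneg n m) (sq_nonneg _)).1 h0 n (Finset.mem_univ n)
    have h2 := (Finset.sum_eq_zero_iff_of_nonneg fun m _ =>
      mul_nonneg (G.w_nonneg n m) (sq_nonneg _)).1 h1 m (Finset.mem_univ m)
    have h3 := (mul_eq_zero.1 h2).resolve_left (G.w_pos n m h).ne'
    exact sub_eq_zero.1 (pow_eq_zero_iff two_ne_zero |>.1 h3)
  obtain ⟨p⟩ := G.connected.preconnected n m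
  induction p with
  | nil => rfl
  | cons h _ ih => exact (hadj _ _ h).trans ih

/-- The summand is antisymmetric in `n` and `m`. -/
theorem sum_L_apply (x : Vec N) : ∑ n, Matrix.toEuclideanLin G.L x n = 0 := by
  have e : ∑ n, Matrix.toEuclideanLin G.L x n = -∑ n, Matrix.toEuclideanLin G.L x n := by
    simp only [G.L_apply]
    conv_lhs => rw [Finset.sum_comm]
    rw [← Finset.sum_neg_distrib]
    refine Finset.sum_congr rfl fun n _ => ?_
    rw [← Finset.sum_neg_distrib]
    exact Finset.sum_congr rfl fun m _ => by rw [G.w_symm]; ring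
  linarith

/-- The range of the Laplacian of a connected graph consists of the vectors of zero sum. -/
theorem exists_L_eq {b : Vec N} (hb : ∑ n, b n = 0) : ∃ x, Matrix.toEuclideanLin G.L x = b := by
  have hsym : (Matrix.toEuclideanLin G.L).IsSymmetric := inner_toEuclideanLin_comm G.L_isHermitian
  -- For a symmetric operator the range is the orthogonal complement of the kernel, here the
  -- constant vectors.
  have h1 : b ∈ (LinearMap.ker (Matrix.toEuclideanLin G.L))ᗮ := by
    rw [Submodule.mem_orthogonal]
    intro u hu
    have hc := G.eq_of_L_eq_zero (LinearMap.mem_ker.1 hu)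
    rw [PiLp.inner_apply]
    obtain ⟨n₀⟩ := G.connected.nonempty
    have : ∀ n, inner ℝ (u n) (b n) = u n₀ * b n := fun n => by
      rw [hc n n₀]
      simp [mul_comm]
    simp only [this, ← Finset.mul_sum, hb, mul_zero]
  rw [← hsym.orthogonal_range, Submodule.orthogonal_orthogonal] at h1
  exact h1

theorem norm_L_sq_le (x : Vec N) : ‖Matrix.toEuclideanLin G.L x‖ ^ 2
    ≤ lamMax G.L * inner ℝ (Matrix.toEuclideanLin G.L x) x :=
  norm_sq_le_lamMax_mul_inner G.L_isHermitian G.inner_L_self_nonneg x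

/-- With two nodes a unit vector is not constant, so `L` does not annihilate it. -/
theorem lamMax_L_pos (hN : 2 ≤ N) : 0 < lamMax G.L := by
  set x : Vec N := EuclideanSpace.single ⟨0, by omega⟩ (1 : ℝ) with hx
  have hne : Matrix.toEuclideanLin G.L x ≠ 0 := fun h => by
    have := G.eq_of_L_eq_zero h ⟨0, by omega⟩ ⟨1, by omega⟩
    simp [hx] at this
  have h1 := G.norm_L_sq_le x
  have h2 : 0 < ‖Matrix.toEuclideanLin G.L x‖ ^ 2 := by
    have := norm_pos_iff.2 hne
    positivity
  exact pos_of_mul_pos_left (h2.trans_le h1) (G.inner_L_self_nonneg x)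

/-- The vector in `ℝ^N` of the `i`-th entries of the blocks of a stacked vector. -/
def _root_.AggGame.col {N H : ℕ} (v : BigVec N H) (i : CIdx N H) : Vec N :=
  WithLp.toLp 2 fun n => v (n, i)

theorem _root_.AggGame.inner_eq_sum_col {N H : ℕ} (u v : BigVec N H) :
    inner ℝ u v = ∑ i, inner ℝ (col u i) (col v i) := by
  simp only [PiLp.inner_apply, col]
  rw [Fintype.sum_prod_type, Finset.sum_comm]

variable {H : ℕ}

theorem Llam_apply (v : BigVec N H) (n : Fin N) (i : CIdx N H) :
    Matrix.toEuclideanLin (G.Llam H) v (n, i) = Matrix.toEuclideanLin G.L (col v i) n := by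
  rw [Matrix.toLpLin_apply, Matrix.toLpLin_apply]
  simp only [Matrix.mulVec, dotProduct, Llam, Matrix.kroneckerMap_apply, Matrix.one_apply,
    Fintype.sum_prod_type, col]
  simp

theorem col_Llam (v : BigVec N H) (i : CIdx N H) :
    col (Matrix.toEuclideanLin (G.Llam H) v) i = Matrix.toEuclideanLin G.L (col v i) := by
  ext n
  exact G.Llam_apply v n i

theorem inner_Llam_comm (u v : BigVec N H) :
    inner ℝ (Matrix.toEuclideanLin (G.Llam H) u) v
      = inner ℝ u (Matrix.toEuclideanLin (G.Llam H) v) := by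
  simp only [inner_eq_sum_col, col_Llam, inner_toEuclideanLin_comm G.L_isHermitian]

/-- `L ⊗ I` acts as `L` on each column, so it inherits the bound with `lamMax G.L` itself. -/
theorem norm_Llam_sq_le (v : BigVec N H) : ‖Matrix.toEuclideanLin (G.Llam H) v‖ ^ 2
    ≤ lamMax G.L * inner ℝ (Matrix.toEuclideanLin (G.Llam H) v) v := by
  rw [← real_inner_self_eq_norm_sq, inner_eq_sum_col, inner_eq_sum_col, Finset.mul_sum]
  refine Finset.sum_le_sum fun i _ => ?_
  rw [col_Llam, real_inner_self_eq_norm_sq]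
  exact G.norm_L_sq_le _

theorem _root_.AggGame.norm_le_mul_of_norm_sq_le {E : Type*} [NormedAddCommGroup E]
    [InnerProductSpace ℝ E] {l : ℝ} (hl : 0 < l) {x y : E} (h : ‖y‖ ^ 2 ≤ l * inner ℝ y x) :
    ‖y‖ ≤ l * ‖x‖ := by
  have h1 := real_inner_le_norm y x
  have h2 : ‖y‖ * ‖y‖ ≤ ‖y‖ * (l * ‖x‖) := by nlinarith
  by_cases hy : ‖y‖ = 0
  · rw [hy]; positivity
  · exact le_of_mul_le_mul_left h2 (lt_of_le_of_ne (norm_nonneg _) (Ne.symm hy))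

end CommGraph

/-! ### Eigenvalue bounds for binary quadratic forms. -/

/-- Cauchy–Schwarz for `(p - q, 2h)` and `(b² - s², 2bs)`, the latter of length `b² + s²`. -/
theorem abs_quadratic_le (p q h b s : ℝ) :
    |(p - q) * (b ^ 2 - s ^ 2) + 4 * h * (b * s)| ≤ √((p - q) ^ 2 + 4 * h ^ 2) * (b ^ 2 + s ^ 2) := by
  have h0 : 0 ≤ b ^ 2 + s ^ 2 := by positivity
  rw [← Real.sqrt_sq h0, ← Real.sqrt_mul (by positivity)]
  refine Real.abs_le_sqrt ?_
  have : 0 ≤ ((p - q) * (2 * (b * s)) - 2 * h * (b ^ 2 - s ^ 2)) ^ 2 := sq_nonneg _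
  nlinarith

/-- Lower bound of a binary quadratic form by its smallest eigenvalue. -/
theorem quadratic_ge (p q h b s : ℝ) :
    (p + q - √((p - q) ^ 2 + 4 * h ^ 2)) / 2 * (b ^ 2 + s ^ 2)
      ≤ p * b ^ 2 + 2 * h * (b * s) + q * s ^ 2 := by
  have := (abs_le.1 (abs_quadratic_le p q h b s)).1
  linarith

/-- Upper bound of a binary quadratic form by its largest eigenvalue. -/
theorem quadratic_le (p q h b s : ℝ) :
    p * b ^ 2 + 2 * h * (b * s) + q * s ^ 2
      ≤ (p + q + √((p - q) ^ 2 + 4 * h ^ 2)) / 2 * (b ^ 2 + s ^ 2) := by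
  have := (abs_le.1 (abs_quadratic_le p q h b s)).2
  linarith

/-! ### The constants, cocoercivity of the 2×2 blocks, and the pseudo-gradient. -/

namespace Network

variable {N H : ℕ} (g : Network N H)

theorem hasDerivAt_cost (n : Fin N) (x : ℝ) :
    HasDerivAt (g.cost n) (2 * g.a n * x + g.b n) x := by
  have h1 : HasDerivAt (fun y => g.a n * y + g.b n) (g.a n) x := by
    simpa using ((hasDerivAt_id x).const_mul (g.a n)).add_const (g.b n)
  have h2 := h1.mul (hasDerivAt_id x)
  exact h2.congr_deriv (by simp only [id]; ring)

theorem fLoc_eq (n : Fin N) (b s : ℝ) :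
    g.fLoc n b s = ((N : ℝ) - 1) / N * (2 * g.a n * ((g.r - N * s) / N + b) + g.b n)
      + ((N * s - g.r) * ((N : ℝ) - 2) + N * b) / (g.α * (N : ℝ) ^ 2) := by
  rw [fLoc, (g.hasDerivAt_cost n _).deriv]

theorem fLoc_sub (hN : 0 < N) (n : Fin N) (b s b' s' : ℝ) :
    g.fLoc n b s - g.fLoc n b' s' = g.mu n * (b - b') + g.ell n * (s - s') := by
  have h1 : (N : ℝ) ≠ 0 := by positivity
  have h2 := g.α_pos.ne'
  rw [fLoc_eq, fLoc_eq, mu, ell]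
  field_simp
  ring

theorem mu_pos (hN : 0 < N) (n : Fin N) : 0 < g.mu n := by
  have h1 : (1 : ℝ) ≤ N := by exact_mod_cast hN
  have h2 := g.α_pos
  have h3 := g.a_pos n
  have h4 : 0 ≤ ((N : ℝ) - 1) / N := div_nonneg (by linarith) (by linarith)
  rw [mu]
  positivity

theorem gam_sq (hN : 0 < N) : g.gam ^ 2 = ((N : ℝ) - 1) / (g.α * N) := by
  have h1 : (1 : ℝ) ≤ N := by exact_mod_cast hN
  have h2 := g.α_pos
  rw [gam, Real.sq_sqrt (div_nonneg (by linarith) (by positivity))]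

theorem ell_eq (hN : 0 < N) (n : Fin N) : g.ell n = g.gam ^ 2 - g.mu n := by
  have h1 : (N : ℝ) ≠ 0 := by positivity
  have h2 := g.α_pos.ne'
  rw [g.gam_sq hN, mu, ell]
  field_simp
  ring

variable {g} {κ : ℝ} (hκ : κ ∈ g.kappaInterval)
include hκ

theorem kappa_bounds (n : Fin N) :
    (√(g.mu n) - g.gam) ^ 2 < κ ∧ κ < (√(g.mu n) + g.gam) ^ 2 :=
  ⟨(le_ciSup (f := fun n => (√(g.mu n) - g.gam) ^ 2) (Set.finite_range _).bddAbove n).trans_lt hκ.1,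
    hκ.2.trans_le (ciInf_le (f := fun n => (√(g.mu n) + g.gam) ^ 2) (Set.finite_range _).bddBelow n)⟩

/-- The interval is empty otherwise: for `N = 0` both endpoints take the default value `0`, and for
`N = 1` they coincide since `γ = 0`. -/
theorem two_le_of_kappa : 2 ≤ N := by
  by_contra! h
  interval_cases N
  · have h1 := hκ.1
    have h2 := hκ.2
    rw [Real.iSup_of_isEmpty] at h1
    rw [Real.iInf_of_isEmpty] at h2
    linarith
  · have hg : g.gam = 0 := by simp [gam]
    have h1 := kappa_bounds hκ 0
    rw [hg, sub_zero, add_zero] at h1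
    linarith [h1.1, h1.2]

theorem kappa_pos : 0 < κ :=
  (sq_nonneg _).trans_lt (kappa_bounds hκ ⟨0, by have := two_le_of_kappa hκ; omega⟩).1

/-- Positive definiteness of the symmetric part of the 2×2 block. With `ℓ = γ² - μ` the difference
of the two sides is Heron's product for a triangle of sides `√μ`, `√κ`, `γ`, and the bounds on `κ`
make every factor positive. -/
theorem ell_sub_kappa_sq_lt (n : Fin N) : (g.ell n - κ) ^ 2 < 4 * (g.mu n * κ) := by
  have hN : 0 < N := by have := two_le_of_kappa hκ; omega
  have hmu := g.mu_pos hN n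
  have hκ0 := kappa_pos hκ
  obtain ⟨h1, h2⟩ := kappa_bounds hκ n
  have hγ : 0 ≤ g.gam := Real.sqrt_nonneg _
  rw [g.ell_eq hN]
  obtain ⟨u, hu, hu'⟩ : ∃ u, 0 < u ∧ g.mu n = u ^ 2 :=
    ⟨√(g.mu n), Real.sqrt_pos.2 hmu, (Real.sq_sqrt hmu.le).symm⟩
  obtain ⟨v, hv, rfl⟩ : ∃ v, 0 < v ∧ κ = v ^ 2 :=
    ⟨√κ, Real.sqrt_pos.2 hκ0, (Real.sq_sqrt hκ0.le).symm⟩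
  rw [hu', Real.sqrt_sq hu.le] at h1 h2
  rw [hu']
  have h3 := abs_lt_of_sq_lt_sq h1 hv.le
  have h4 := lt_of_pow_lt_pow_left₀ 2 (by positivity) h2
  rw [abs_lt] at h3
  have e : 4 * (u ^ 2 * v ^ 2) - (g.gam ^ 2 - u ^ 2 - v ^ 2) ^ 2
      = (g.gam + u - v) * (v - u + g.gam) * ((u + v - g.gam) * (u + v + g.gam)) := by ring
  have : 0 < (g.gam + u - v) * (v - u + g.gam) * ((u + v - g.gam) * (u + v + g.gam)) :=
    mul_pos (mul_pos (by linarith) (by linarith)) (mul_pos (by linarith) (by linarith))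
  linarith

theorem epsUpper_pos (n : Fin N) : 0 < g.epsUpper κ n := by
  have hN : 0 < N := by have := two_le_of_kappa hκ; omega
  have hmu := g.mu_pos hN n
  have hκ0 := kappa_pos hκ
  have h := ell_sub_kappa_sq_lt hκ n
  have : √((g.mu n - κ) ^ 2 + (g.ell n - κ) ^ 2) < κ + g.mu n := by
    rw [Real.sqrt_lt' (by positivity)]
    nlinarith
  rw [epsUpper]
  linarith

theorem epsLower_pos (n : Fin N) : 0 < g.epsLower κ n := by
  have hκ0 := kappa_pos hκ
  rw [epsLower]
  positivity

theorem iInf_epsUpper_pos : 0 < ⨅ n, g.epsUpper κ n := by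
  have hN : 0 < N := by have := two_le_of_kappa hκ; omega
  have : Nonempty (Fin N) := ⟨⟨0, hN⟩⟩
  obtain ⟨n, hn⟩ := exists_eq_ciInf_of_finite (f := g.epsUpper κ)
  rw [← hn]
  exact epsUpper_pos hκ n

theorem iSup_epsLower_pos : 0 < ⨆ n, g.epsLower κ n := by
  have hN : 0 < N := by have := two_le_of_kappa hκ; omega
  exact (epsLower_pos hκ ⟨0, hN⟩).trans_le (le_ciSup (Set.finite_range _).bddAbove _)

theorem epsTil_pos : 0 < g.epsTil κ := div_pos (iInf_epsUpper_pos hκ) (iSup_epsLower_pos hκ)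

-- Half of `epsUpper` is the smallest eigenvalue of the symmetric part of the matrix with rows `(μ,
-- ℓ)` and `(-κ, κ)`.
omit hκ in
theorem iInf_epsUpper_mul_le (n : Fin N) (b s : ℝ) :
    (⨅ n, g.epsUpper κ n) / 2 * (b ^ 2 + s ^ 2)
      ≤ (g.mu n * b + g.ell n * s) * b + κ * (s - b) * s := by
  have h1 : (⨅ n, g.epsUpper κ n) ≤ g.epsUpper κ n := ciInf_le (Set.finite_range _).bddBelow n
  have h2 := quadratic_ge (g.mu n) κ ((g.ell n - κ) / 2) b s
  have h3 : (g.mu n - κ) ^ 2 + 4 * ((g.ell n - κ) / 2) ^ 2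
      = (g.mu n - κ) ^ 2 + (g.ell n - κ) ^ 2 := by ring
  rw [h3] at h2
  have h4 : (⨅ n, g.epsUpper κ n) / 2 * (b ^ 2 + s ^ 2) ≤ g.epsUpper κ n / 2 * (b ^ 2 + s ^ 2) := by
    gcongr
  rw [epsUpper] at h4
  linarith

-- Half of `epsLower` is the largest eigenvalue of the Gram matrix of the same map; replacing `s` by
-- `-s` matches the sign of the off-diagonal entry.
omit hκ in
theorem sq_add_sq_le (n : Fin N) (b s : ℝ) :
    (g.mu n * b + g.ell n * s) ^ 2 + (κ * (s - b)) ^ 2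
      ≤ (⨆ n, g.epsLower κ n) / 2 * (b ^ 2 + s ^ 2) := by
  have h1 : g.epsLower κ n ≤ ⨆ n, g.epsLower κ n := le_ciSup (Set.finite_range _).bddAbove n
  have h2 := quadratic_le (g.mu n ^ 2 + κ ^ 2) (g.ell n ^ 2 + κ ^ 2) (κ ^ 2 - g.mu n * g.ell n)
    b (-s)
  have h3 : (g.mu n ^ 2 + κ ^ 2 - (g.ell n ^ 2 + κ ^ 2)) ^ 2
      = (g.mu n + g.ell n) ^ 2 * (g.mu n - g.ell n) ^ 2 := by ring
  rw [h3] at h2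
  have h4 : g.epsLower κ n / 2 * (b ^ 2 + s ^ 2) ≤ (⨆ n, g.epsLower κ n) / 2 * (b ^ 2 + s ^ 2) := by
    gcongr
  rw [epsLower] at h4
  linarith

/-- Cocoercivity of the map `(b, s) ↦ (μ b + ℓ s, κ (s - b))`. -/
theorem epsTil_mul_le (n : Fin N) (b s : ℝ) :
    g.epsTil κ * ((g.mu n * b + g.ell n * s) ^ 2 + (κ * (s - b)) ^ 2)
      ≤ (g.mu n * b + g.ell n * s) * b + κ * (s - b) * s := by
  have h1 := iSup_epsLower_pos hκ
  have h2 := epsTil_pos hκ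
  calc _ ≤ g.epsTil κ * ((⨆ n, g.epsLower κ n) / 2 * (b ^ 2 + s ^ 2)) := by
        gcongr
        exact sq_add_sq_le n b s
    _ = (⨅ n, g.epsUpper κ n) / 2 * (b ^ 2 + s ^ 2) := by
        rw [epsTil]
        field_simp
    _ ≤ _ := iInf_epsUpper_mul_le n b s

omit hκ

variable (g)

/-- The average bid. -/
def avg {N : ℕ} (β : Vec N) : ℝ := (∑ n, β n) / N

/-- `J̄_n` is quadratic in the bid of `n`. -/
theorem J_setBid (n : Fin N) (β : Vec N) (t : ℝ) :
    g.J n (setBid β n t) = g.J n β + g.fLoc n (β n) (avg β) * (t - β n)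
      + (g.a n * (((N : ℝ) - 1) / N) ^ 2 + (((N : ℝ) - 1) / N) / (g.α * N)) * (t - β n) ^ 2 := by
  have hN : 0 < N := n.pos
  have h1 : (N : ℝ) ≠ 0 := by positivity
  have h2 := g.α_pos.ne'
  have hsum : ∑ m, setBid β n t m = ∑ m, β m + (t - β n) := by
    simp only [setBid]
    rw [Finset.sum_update_of_mem (Finset.mem_univ n),
      ← Finset.add_sum_erase _ _ (Finset.mem_univ n), Finset.sdiff_singleton_eq_erase]
    ring
  have hn : setBid β n t n = t := by simp [setBid]
  rw [fLoc_eq]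
  simp only [J, load, price, hsum, hn, cost, avg]
  generalize ∑ m, β m = S
  field_simp
  ring

theorem F_apply (β : Vec N) (n : Fin N) : g.F β n = g.fLoc n (β n) (avg β) := by
  change deriv (fun t => g.J n (setBid β n t)) (β n) = _
  set f := g.fLoc n (β n) (avg β) with hf
  set c := g.a n * (((N : ℝ) - 1) / N) ^ 2 + (((N : ℝ) - 1) / N) / (g.α * N) with hc
  have h : (fun t => g.J n (setBid β n t))
      = fun t => g.J n β + f * (t - β n) + c * (t - β n) ^ 2 :=
    funext fun t => g.J_setBid n β t
  rw [h]
  have h1 : HasDerivAt (fun t => t - β n) 1 (β n) := (hasDerivAt_id _).sub_const _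
  have h2 := ((h1.const_mul f).const_add (g.J n β)).add ((h1.pow 2).const_mul c)
  have h3 := h2.deriv
  simp only [sub_self] at h3
  refine Eq.trans ?_ (h3.trans ?_)
  · rfl
  · simp

theorem F_sub_apply (x y : Vec N) (n : Fin N) :
    (g.F x - g.F y) n = g.mu n * (x - y) n + g.ell n * avg (x - y) := by
  rw [PiLp.sub_apply, F_apply, F_apply, g.fLoc_sub n.pos]
  simp only [avg, PiLp.sub_apply, Finset.sum_sub_distrib]
  ring

theorem sum_sub_avg (β : Vec N) : ∑ n, (avg β - β n) = 0 := by
  rcases Nat.eq_zero_or_pos N with rfl | hN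
  · simp
  · rw [Finset.sum_sub_distrib, Finset.sum_const, Finset.card_univ, Fintype.card_fin, avg,
      nsmul_eq_mul]
    have : (N : ℝ) ≠ 0 := by positivity
    field_simp
    ring

variable {g}

include hκ in
/-- The pseudo-gradient is strongly monotone. -/
theorem F_stronglyMonotone (x y : Vec N) :
    (⨅ n, g.epsUpper κ n) / 2 * ‖x - y‖ ^ 2 ≤ inner ℝ (g.F x - g.F y) (x - y) := by
  set u := x - y with hu
  -- The added term sums to zero because deviations from the average do. It turns the nonlocal form
  -- into a sum of 2×2 forms with `s = avg u`.
  have h1 : inner ℝ (g.F x - g.F y) u = ∑ n, ((g.mu n * u n + g.ell n * avg u) * u n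
      + κ * (avg u - u n) * avg u) := by
    rw [Finset.sum_add_distrib, ← Finset.sum_mul, ← Finset.mul_sum, sum_sub_avg, mul_zero, zero_mul,
      add_zero, real_inner_comm, PiLp.inner_apply]
    refine Finset.sum_congr rfl fun n _ => ?_
    rw [F_sub_apply]
    simp [u]
  rw [h1, EuclideanSpace.norm_sq_eq, Finset.mul_sum]
  refine Finset.sum_le_sum fun n _ => le_trans ?_ (iInf_epsUpper_mul_le n _ _)
  have := iInf_epsUpper_pos hκ
  gcongr
  rw [Real.norm_eq_abs, sq_abs]
  have := sq_nonneg (avg u)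
  linarith

theorem exists_lipschitz_F : ∃ l : ℝ, ∀ x y, ‖g.F x - g.F y‖ ≤ l * ‖x - y‖ := by
  let T : Vec N →ₗ[ℝ] Vec N :=
    { toFun := fun u => WithLp.toLp 2 fun n => g.mu n * u n + g.ell n * avg u
      map_add' := fun u v => by
        ext n
        simp only [avg, PiLp.add_apply, Finset.sum_add_distrib]
        ring
      map_smul' := fun c u => by
        ext n
        simp only [avg, PiLp.smul_apply, smul_eq_mul, ← Finset.mul_sum, RingHom.id_apply]
        ring }
  refine ⟨‖LinearMap.toContinuousLinearMap T‖, fun x y => ?_⟩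
  have : g.F x - g.F y = LinearMap.toContinuousLinearMap T (x - y) := by
    ext n
    rw [F_sub_apply]
    rfl
  rw [this]
  exact ContinuousLinearMap.le_opNorm _ _

end Network

/-! ### The five-fold Hilbert sum, the preconditioner and the skew operator. -/

section BlockOperators

variable {V W : Type*} [NormedAddCommGroup V] [InnerProductSpace ℝ V]
  [NormedAddCommGroup W] [InnerProductSpace ℝ W]

/-- The Hilbert sum `V ⊕ V ⊕ V ⊕ W ⊕ W`. -/
abbrev HSum (V W : Type*) : Type _ :=
  WithLp 2 (V × WithLp 2 (V × WithLp 2 (V × WithLp 2 (W × W))))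

/-- The element of the Hilbert sum with given components. -/
def hmk (β ψ σ : V) (z lam : W) : HSum V W :=
  WithLp.toLp 2 (β, WithLp.toLp 2 (ψ, WithLp.toLp 2 (σ, WithLp.toLp 2 (z, lam))))

theorem exists_eq_hmk (x : HSum V W) : ∃ β ψ σ z lam, x = hmk β ψ σ z lam :=
  ⟨x.fst, x.snd.fst, x.snd.snd.fst, x.snd.snd.snd.fst, x.snd.snd.snd.snd, rfl⟩

theorem hmk_sub (β ψ σ β' ψ' σ' : V) (z lam z' lam' : W) :
    hmk β ψ σ z lam - hmk β' ψ' σ' z' lam' = hmk (β - β') (ψ - ψ') (σ - σ') (z - z') (lam - lam') :=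
  rfl

theorem hmk_add (β ψ σ β' ψ' σ' : V) (z lam z' lam' : W) :
    hmk β ψ σ z lam + hmk β' ψ' σ' z' lam' = hmk (β + β') (ψ + ψ') (σ + σ') (z + z') (lam + lam') :=
  rfl

theorem hmk_smul (c : ℝ) (β ψ σ : V) (z lam : W) :
    c • hmk β ψ σ z lam = hmk (c • β) (c • ψ) (c • σ) (c • z) (c • lam) :=
  rfl

theorem hmk_zero : hmk (0 : V) 0 0 (0 : W) 0 = 0 := rfl

theorem inner_hmk (β ψ σ β' ψ' σ' : V) (z lam z' lam' : W) :
    inner ℝ (hmk β ψ σ z lam) (hmk β' ψ' σ' z' lam')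
      = inner ℝ β β' + inner ℝ ψ ψ' + inner ℝ σ σ' + inner ℝ z z' + inner ℝ lam lam' := by
  simp only [hmk, WithLp.prod_inner_apply]
  ring

theorem norm_sq_hmk (β ψ σ : V) (z lam : W) :
    ‖hmk β ψ σ z lam‖ ^ 2 = ‖β‖ ^ 2 + ‖ψ‖ ^ 2 + ‖σ‖ ^ 2 + ‖z‖ ^ 2 + ‖lam‖ ^ 2 := by
  simp only [← real_inner_self_eq_norm_sq, inner_hmk]

theorem continuous_hmk {X : Type*} [TopologicalSpace X] {β ψ σ : X → V} {z lam : X → W}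
    (h1 : Continuous β) (h2 : Continuous ψ) (h3 : Continuous σ) (h4 : Continuous z)
    (h5 : Continuous lam) : Continuous fun x => hmk (β x) (ψ x) (σ x) (z x) (lam x) := by
  unfold hmk
  exact (WithLp.prod_continuous_toLp 2 _ _).comp (h1.prodMk ((WithLp.prod_continuous_toLp 2 _ _).comp
    (h2.prodMk ((WithLp.prod_continuous_toLp 2 _ _).comp
      (h3.prodMk ((WithLp.prod_continuous_toLp 2 _ _).comp (h4.prodMk h5)))))))

/-- Carries convergence in the Hilbert sum back to the plain product `State`. -/
theorem continuous_components : Continuous fun x : HSum V W =>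
    (x.fst, x.snd.fst, x.snd.snd.fst, x.snd.snd.snd.fst, x.snd.snd.snd.snd) := by
  have h1 := WithLp.prod_continuous_ofLp 2 V (WithLp 2 (V × WithLp 2 (V × WithLp 2 (W × W))))
  have h2 := (WithLp.prod_continuous_ofLp 2 V (WithLp 2 (V × WithLp 2 (W × W)))).comp h1.snd
  have h3 := (WithLp.prod_continuous_ofLp 2 V (WithLp 2 (W × W))).comp h2.snd
  have h4 := (WithLp.prod_continuous_ofLp 2 W W).comp h3.snd
  exact h1.fst.prodMk (h2.fst.prodMk (h3.fst.prodMk (h4.fst.prodMk h4.snd)))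

variable (Dτ Dυ Dρ L : V →ₗ[ℝ] V) (Dδ Dη Lw : W →ₗ[ℝ] W) (B : V →ₗ[ℝ] W) (Bt : W →ₗ[ℝ] V)

/-- The preconditioner. -/
def precond : HSum V W →ₗ[ℝ] HSum V W where
  -- Added to `skewOp` at the new point, the off-diagonal terms in the `β`, `ψ`, `z` rows leave only
  -- old iterates; those in the `σ`, `lam` rows become the extrapolations `2 x' - x`.
  toFun x := hmk (Dτ x.fst - Bt x.snd.snd.snd.snd) (Dυ x.snd.fst + L x.snd.snd.fst)
    (Dρ x.snd.snd.fst + L x.snd.fst) (Dδ x.snd.snd.snd.fst + Lw x.snd.snd.snd.snd)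
    (Dη x.snd.snd.snd.snd - B x.fst + Lw x.snd.snd.snd.fst)
  map_add' x y := by
    rw [hmk_add]
    simp only [WithLp.add_fst, WithLp.add_snd, map_add]
    congr 1 <;> abel
  map_smul' c x := by
    rw [RingHom.id_apply, hmk_smul]
    simp only [WithLp.smul_fst, WithLp.smul_snd, map_smul, smul_add, smul_sub]

/-- The skew part of the set-valued operator. -/
def skewOp : HSum V W →ₗ[ℝ] HSum V W where
  toFun x := hmk (Bt x.snd.snd.snd.snd) (-L x.snd.snd.fst) (L x.snd.fst)
    (-Lw x.snd.snd.snd.snd) (-B x.fst + Lw x.snd.snd.snd.fst)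
  map_add' x y := by
    rw [hmk_add]
    simp only [WithLp.add_fst, WithLp.add_snd, map_add]
    congr 1 <;> abel
  map_smul' c x := by
    rw [RingHom.id_apply, hmk_smul]
    simp only [WithLp.smul_fst, WithLp.smul_snd, map_smul, smul_add, smul_neg]

theorem precond_hmk (β ψ σ : V) (z lam : W) :
    precond Dτ Dυ Dρ L Dδ Dη Lw B Bt (hmk β ψ σ z lam)
      = hmk (Dτ β - Bt lam) (Dυ ψ + L σ) (Dρ σ + L ψ) (Dδ z + Lw lam) (Dη lam - B β + Lw z) :=
  rfl

theorem skewOp_hmk (β ψ σ : V) (z lam : W) :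
    skewOp L Lw B Bt (hmk β ψ σ z lam)
      = hmk (Bt lam) (-L σ) (L ψ) (-Lw lam) (-B β + Lw z) :=
  rfl

variable {Dτ Dυ Dρ L Dδ Dη Lw B Bt}

theorem inner_skewOp_self (hL : ∀ x y, inner ℝ (L x) y = inner ℝ x (L y))
    (hLw : ∀ x y, inner ℝ (Lw x) y = inner ℝ x (Lw y))
    (hB : ∀ x y, inner ℝ (Bt x) y = inner ℝ x (B y)) (x : HSum V W) :
    inner ℝ (skewOp L Lw B Bt x) x = 0 := by
  obtain ⟨β, ψ, σ, z, lam, rfl⟩ := exists_eq_hmk x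
  rw [skewOp_hmk, inner_hmk]
  simp only [inner_add_left, inner_neg_left]
  rw [hB, hL ψ, hLw z, real_inner_comm _ (B β), real_inner_comm _ ψ, real_inner_comm _ z]
  ring

theorem inner_precond_comm (hτ : ∀ x y, inner ℝ (Dτ x) y = inner ℝ x (Dτ y))
    (hυ : ∀ x y, inner ℝ (Dυ x) y = inner ℝ x (Dυ y))
    (hρ : ∀ x y, inner ℝ (Dρ x) y = inner ℝ x (Dρ y))
    (hδ : ∀ x y, inner ℝ (Dδ x) y = inner ℝ x (Dδ y))
    (hη : ∀ x y, inner ℝ (Dη x) y = inner ℝ x (Dη y))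
    (hL : ∀ x y, inner ℝ (L x) y = inner ℝ x (L y))
    (hLw : ∀ x y, inner ℝ (Lw x) y = inner ℝ x (Lw y))
    (hB : ∀ x y, inner ℝ (Bt x) y = inner ℝ x (B y)) (x y : HSum V W) :
    inner ℝ (precond Dτ Dυ Dρ L Dδ Dη Lw B Bt x) y
      = inner ℝ x (precond Dτ Dυ Dρ L Dδ Dη Lw B Bt y) := by
  obtain ⟨β, ψ, σ, z, lam, rfl⟩ := exists_eq_hmk x
  obtain ⟨β', ψ', σ', z', lam', rfl⟩ := exists_eq_hmk y
  have hB' : inner ℝ β (Bt lam') = inner ℝ (B β) lam' := by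
    rw [real_inner_comm, hB, real_inner_comm]
  rw [precond_hmk, precond_hmk, inner_hmk, inner_hmk]
  simp only [inner_add_left, inner_sub_left, inner_add_right, inner_sub_right]
  rw [hτ, hυ, hρ, hδ, hη, hB, hB', hL, hL, hLw, hLw]
  ring

/-- Young's inequality with weight `t`; the factor `a² t⁻¹` is the form in which cross terms enter
the conditions on `ρ` and `η`. -/
theorem abs_two_mul_inner_le {E : Type*} [NormedAddCommGroup E] [InnerProductSpace ℝ E]
    {t a : ℝ} (ht : 0 < t) {u v : E} {c : ℝ} (hu : ‖u‖ ≤ a * c) :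
    |2 * inner ℝ u v| ≤ t * c ^ 2 + a ^ 2 * t⁻¹ * ‖v‖ ^ 2 := by
  have h1 := abs_real_inner_le_norm u v
  have h2 : ‖u‖ * ‖v‖ ≤ a * c * ‖v‖ := by gcongr
  have h3 : 0 ≤ t⁻¹ * (t * c - a * ‖v‖) ^ 2 := by positivity
  have h4 : t⁻¹ * (t * c - a * ‖v‖) ^ 2
      = t * c ^ 2 - 2 * (a * c * ‖v‖) + a ^ 2 * t⁻¹ * ‖v‖ ^ 2 := by
    field_simp
    ring
  rw [abs_mul, abs_two]
  linarith

/-- A diagonally dominant preconditioner is positive definite with margin `h`. -/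
theorem lt_inner_precond_self {h t u d a l : ℝ} (ht : 0 < t) (hu : 0 < u) (hd : 0 < d)
    (hτ : ∀ x, (t + h) * ‖x‖ ^ 2 ≤ inner ℝ (Dτ x) x)
    (hυ : ∀ x, (u + h) * ‖x‖ ^ 2 ≤ inner ℝ (Dυ x) x)
    (hδ : ∀ x, (d + h) * ‖x‖ ^ 2 ≤ inner ℝ (Dδ x) x)
    (hρ : ∀ x, x ≠ 0 → (l ^ 2 * u⁻¹ + h) * ‖x‖ ^ 2 < inner ℝ (Dρ x) x)
    (hη : ∀ x, x ≠ 0 → (a ^ 2 * t⁻¹ + l ^ 2 * d⁻¹ + h) * ‖x‖ ^ 2 < inner ℝ (Dη x) x)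
    (hL : ∀ x y, inner ℝ (L x) y = inner ℝ x (L y))
    (hLw : ∀ x y, inner ℝ (Lw x) y = inner ℝ x (Lw y))
    (hB : ∀ x y, inner ℝ (Bt x) y = inner ℝ x (B y))
    (hLn : ∀ x, ‖L x‖ ≤ l * ‖x‖) (hLwn : ∀ x, ‖Lw x‖ ≤ l * ‖x‖) (hBn : ∀ x, ‖B x‖ ≤ a * ‖x‖)
    (x : HSum V W) (hx : x ≠ 0) :
    h * ‖x‖ ^ 2 < inner ℝ (precond Dτ Dυ Dρ L Dδ Dη Lw B Bt x) x := by
  obtain ⟨β, ψ, σ, z, lam, rfl⟩ := exists_eq_hmk x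
  have e : inner ℝ (precond Dτ Dυ Dρ L Dδ Dη Lw B Bt (hmk β ψ σ z lam)) (hmk β ψ σ z lam)
      = inner ℝ (Dτ β) β + inner ℝ (Dυ ψ) ψ + inner ℝ (Dρ σ) σ + inner ℝ (Dδ z) z
        + inner ℝ (Dη lam) lam - 2 * inner ℝ (B β) lam + 2 * inner ℝ (L ψ) σ
        + 2 * inner ℝ (Lw z) lam := by
    rw [precond_hmk, inner_hmk]
    simp only [inner_add_left, inner_sub_left]
    rw [hB, hL σ, hLw lam, real_inner_comm _ (B β), real_inner_comm (L ψ) σ,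
      real_inner_comm (Lw z) lam]
    ring
  rw [e, norm_sq_hmk]
  -- The surpluses `t`, `u`, `d` of the `β`, `ψ`, `z` blocks pay for one side of each cross term;
  -- the `σ` and `lam` blocks pay for the other.
  have h1 := abs_le.1 (abs_two_mul_inner_le ht (hBn β) (v := lam))
  have h2 := abs_le.1 (abs_two_mul_inner_le hu (hLn ψ) (v := σ))
  have h3 := abs_le.1 (abs_two_mul_inner_le hd (hLwn z) (v := lam))
  have hρ' : (l ^ 2 * u⁻¹ + h) * ‖σ‖ ^ 2 ≤ inner ℝ (Dρ σ) σ := by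
    by_cases hσ : σ = 0
    · simp [hσ]
    · exact (hρ σ hσ).le
  have hη' : (a ^ 2 * t⁻¹ + l ^ 2 * d⁻¹ + h) * ‖lam‖ ^ 2 ≤ inner ℝ (Dη lam) lam := by
    by_cases hl : lam = 0
    · simp [hl]
    · exact (hη lam hl).le
  have hτ' := hτ β
  have hυ' := hυ ψ
  have hδ' := hδ z
  -- Strictness comes from `hρ` or `hη` if `σ` or `lam` is nonzero. Otherwise all cross terms vanish
  -- and the surpluses are strictly positive.
  by_cases hσ : σ = 0
  · by_cases hl : lam = 0
    · subst hσ hl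
      have hne : β ≠ 0 ∨ ψ ≠ 0 ∨ z ≠ 0 := by
        by_contra! hc
        obtain ⟨rfl, rfl, rfl⟩ := hc
        exact hx hmk_zero
      have hpos : 0 < t * ‖β‖ ^ 2 + u * ‖ψ‖ ^ 2 + d * ‖z‖ ^ 2 := by
        rcases hne with hb | hb | hb <;>
        · have := norm_pos_iff.2 hb
          positivity
      simp only [map_zero, inner_zero_right, norm_zero]
      linarith
    · have := hη lam hl
      linarith [h1.2, h2.1, h3.1]
  · have := hρ σ hσ
    linarith [h1.2, h2.1, h3.1]

end BlockOperators

variable {N H : ℕ}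

/-! ### The coupling constraints, and equilibria from the variational inequality. -/

namespace Network

variable (g : Network N H)

theorem Abar_apply (β : Vec N) (n : Fin N) (i : CIdx N H) :
    Matrix.toEuclideanLin g.Abar β (n, i) = g.Atil i n * β n := by
  rw [Matrix.toLpLin_apply]
  simp [Matrix.mulVec, dotProduct, Abar]

theorem Abar_transpose_apply (lam : BigVec N H) (n : Fin N) :
    Matrix.toEuclideanLin g.Abarᵀ lam n = ∑ i, g.Atil i n * lam (n, i) := by
  rw [Matrix.toLpLin_apply]
  simp only [Matrix.mulVec, dotProduct, Abar, Matrix.transpose_apply, Matrix.of_apply,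
    Fintype.sum_prod_type]
  rw [Finset.sum_eq_single n]
  · simp
  · intro m _ hm
    simp [hm]
  · simp

theorem inner_Abar_transpose (lam : BigVec N H) (β : Vec N) :
    inner ℝ (Matrix.toEuclideanLin g.Abarᵀ lam) β
      = inner ℝ lam (Matrix.toEuclideanLin g.Abar β) := by
  simp only [PiLp.inner_apply, Fintype.sum_prod_type, Abar_apply, Abar_transpose_apply]
  refine Finset.sum_congr rfl fun n _ => ?_
  simp only [RCLike.inner_apply, conj_trivial, Finset.mul_sum]
  exact Finset.sum_congr rfl fun i _ => by ring

theorem sum_Abar_apply (β : Vec N) (i : CIdx N H) :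
    ∑ n, Matrix.toEuclideanLin g.Abar β (n, i) = (g.Atil *ᵥ β) i := by
  simp only [Abar_apply]
  rfl

theorem sum_dLoc (hN : 0 < N) (i : CIdx N H) : ∑ n, g.dLoc n i = g.d i := by
  have hN' : (N : ℝ) ≠ 0 := by positivity
  have hconst : ∀ x : ℝ, ∑ _n : Fin N, 1 / (N : ℝ) * x = x := fun x => by
    rw [Finset.sum_const, Finset.card_univ, Fintype.card_fin, nsmul_eq_mul]
    field_simp
  have hflow : ∀ l, ∑ n, (g.flow *ᵥ Pi.single n (g.e n)) l = (g.flow *ᵥ g.e) l := fun l => by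
    simp [Matrix.mulVec, dotProduct, Pi.single_apply]
  rcases i with i | i | i | i
  · simp only [dLoc, d, Pi.add_apply, Pi.smul_apply, Sum.elim_inl, smul_eq_mul, Pi.neg_apply,
      Pi.zero_apply, Finset.sum_add_distrib, hconst, Pi.sub_apply, add_zero]
    rw [Finset.sum_eq_single i (fun m _ hm => by simp [Ne.symm hm]) (by simp)]
    simp only [Pi.single_eq_same]
    ring
  · simp only [dLoc, d, Pi.add_apply, Pi.smul_apply, Sum.elim_inl, Sum.elim_inr, smul_eq_mul,
      Pi.zero_apply, hconst, add_zero]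
  · simp only [dLoc, d, Pi.add_apply, Pi.smul_apply, Sum.elim_inl, Sum.elim_inr, smul_eq_mul,
      Pi.zero_apply, Finset.sum_add_distrib, hconst, add_zero, Pi.neg_apply,
      Finset.sum_neg_distrib, hflow, Matrix.mulVec_sub, Pi.sub_apply]
    ring
  · simp only [dLoc, d, Pi.add_apply, Pi.smul_apply, Sum.elim_inr, smul_eq_mul,
      Pi.zero_apply, Finset.sum_add_distrib, hconst, add_zero,
      hflow, Matrix.mulVec_sub, Pi.sub_apply]
    ring

theorem isClosed_Omega : IsClosed g.Omega := by
  have : g.Omega = ⋂ n, {β : Vec N | β n ∈ Set.Icc g.lo g.hi} := by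
    ext β; simp [Omega]
  rw [this]
  exact isClosed_iInter fun n => isClosed_Icc.preimage (by fun_prop)

theorem convex_Omega : Convex ℝ g.Omega := by
  intro x hx y hy a b ha hb hab n
  exact convex_Icc g.lo g.hi (hx n) (hy n) ha hb hab

theorem isClosed_K : IsClosed g.K := by
  have : g.K = g.Omega ∩ ⋂ i, {β : Vec N | (g.Atil *ᵥ β) i ≤ g.d i} := by
    ext β
    rw [Set.mem_inter_iff, Set.mem_iInter]
    rfl
  rw [this]
  refine g.isClosed_Omega.inter (isClosed_iInter fun i => isClosed_le ?_ continuous_const)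
  simp only [Matrix.mulVec, dotProduct]
  fun_prop

/-- `β ↦ Ã β` as a linear map. -/
def AtilLin : Vec N →ₗ[ℝ] (CIdx N H → ℝ) where
  toFun β := g.Atil *ᵥ β
  map_add' _ _ := Matrix.mulVec_add _ _ _
  map_smul' _ _ := Matrix.mulVec_smul _ _ _

theorem convex_K : Convex ℝ g.K := by
  intro x hx y hy a b ha hb hab
  refine ⟨g.convex_Omega hx.1 hy.1 ha hb hab, fun i => ?_⟩
  have e : (g.Atil *ᵥ (a • x + b • y : Vec N)) i = a * (g.Atil *ᵥ x) i + b * (g.Atil *ᵥ y) i := by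
    change g.AtilLin (a • x + b • y) i = _
    rw [map_add, map_smul, map_smul]
    rfl
  have h1 := mul_le_mul_of_nonneg_left (hx.2 i) ha
  have h2 := mul_le_mul_of_nonneg_left (hy.2 i) hb
  have h3 : a * g.d i + b * g.d i = g.d i := by rw [← add_mul, hab, one_mul]
  rw [e]
  linarith

theorem FLoc_avg {β σ : Vec N} (hσ : ∀ n, σ n = avg β) : g.FLoc β σ = g.F β := by
  ext n
  rw [F_apply, ← hσ n]
  rfl

/-- Solutions of the variational inequality are generalized Nash equilibria. -/
theorem SolvesVI.isVGNE {g : Network N H} {β : Vec N} (h : g.SolvesVI β) : g.IsVGNE β := by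
  refine ⟨⟨h.1, fun n t ht => ?_⟩, h⟩
  -- A feasible unilateral deviation stays in `K`, so the variational inequality may be tested with
  -- it and sees only the `n`-th partial derivative.
  have hmem : setBid β n t ∈ g.K := by
    refine ⟨fun m => ?_, fun i => ?_⟩
    · by_cases hm : m = n
      · subst hm
        simpa [setBid] using ht.1
      · simpa [setBid, hm] using h.1.1 m
    · have e : (g.Atil *ᵥ setBid β n t) i
          = g.Atil i n * t + ∑ m ∈ Finset.univ.erase n, g.Atil i m * β m := by
        simp only [Matrix.mulVec, dotProduct]
        rw [← Finset.add_sum_erase _ _ (Finset.mem_univ n)]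
        congr 1
        · simp [setBid]
        · refine Finset.sum_congr rfl fun m hm => ?_
          simp [setBid, Finset.ne_of_mem_erase hm]
      have := ht.2 i
      rw [e]
      linarith
  have h1 := h.2 _ hmem
  have e : inner ℝ (setBid β n t - β) (g.F β) = g.fLoc n (β n) (avg β) * (t - β n) := by
    rw [PiLp.inner_apply, Finset.sum_eq_single n]
    · rw [F_apply]
      simp [setBid]
    · intro m _ hm
      simp [setBid, hm]
    · simp
  rw [e] at h1
  have hN : (1 : ℝ) ≤ N := by exact_mod_cast n.pos
  have h2 : 0 ≤ ((N : ℝ) - 1) / N := div_nonneg (by linarith) (by linarith)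
  have h3 := g.a_pos n
  have h4 := g.α_pos
  -- The cost is exactly quadratic in the own bid with nonnegative leading coefficient, so
  -- first-order optimality suffices.
  have h5 : 0 ≤ (g.a n * (((N : ℝ) - 1) / N) ^ 2 + (((N : ℝ) - 1) / N) / (g.α * N))
      * (t - β n) ^ 2 := by positivity
  rw [J_setBid]
  linarith

end Network

/-! ### The optimality system: relation to the variational inequality, and existence. -/

section KKT

variable (g : Network N H) (G : CommGraph N) (κ : ℝ)

/-- The inclusion `0 ∈ 𝒜(ω) + ℬ(ω)` written out componentwise. -/
structure SolvesKKT (β ψ σ : Vec N) (z lam : BigVec N H) : Prop where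
  mem_Omega : β ∈ g.Omega
  lam_nonneg : ∀ p, 0 ≤ lam p
  bid : ∀ y ∈ g.Omega, 0 ≤ inner ℝ (g.FLoc β σ + Matrix.toEuclideanLin g.Abarᵀ lam) (y - β)
  consensus_σ : Matrix.toEuclideanLin G.L σ = 0
  tracking : κ • (σ - β) + Matrix.toEuclideanLin G.L ψ = 0
  consensus_lam : Matrix.toEuclideanLin (G.Llam H) lam = 0
  dual : ∀ y : BigVec N H, (∀ p, 0 ≤ y p) → 0 ≤ inner ℝ (g.dbar + Matrix.toEuclideanLin (G.Llam H) lam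
    - Matrix.toEuclideanLin g.Abar β + Matrix.toEuclideanLin (G.Llam H) z) (y - lam)

variable {g G κ} {β ψ σ : Vec N} {z lam : BigVec N H}

theorem SolvesKKT.isZeroAB (h : SolvesKKT g G κ β ψ σ z lam) :
    IsZeroAB g G κ (β, ψ, σ, z, lam) := by
  unfold IsZeroAB
  rw [Set.mem_add]
  refine ⟨_, rfl, -opA g G κ (β, ψ, σ, z, lam), ?_, add_neg_cancel _⟩
  refine ⟨-(g.FLoc β σ + Matrix.toEuclideanLin g.Abarᵀ lam), ⟨h.mem_Omega, fun y hy => ?_⟩,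
    -(g.dbar + Matrix.toEuclideanLin (G.Llam H) lam
    - Matrix.toEuclideanLin g.Abar β + Matrix.toEuclideanLin (G.Llam H) z),
    ⟨h.lam_nonneg, fun y hy => ?_⟩, ?_⟩
  · rw [inner_neg_left]
    linarith [h.bid y hy]
  · rw [inner_neg_left]
    linarith [h.dual y hy]
  · simp only [opA, Prod.neg_mk, Prod.mk.injEq]
    refine ⟨by abel, ?_, ?_, ?_, by abel⟩
    · rw [h.consensus_σ]
    · rw [eq_neg_of_add_eq_zero_right h.tracking]
    · rw [h.consensus_lam]

/-- Summing the tracking equation removes `L ψ`, so `σ` and `β` have equal sums, while `σ` is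
constant on the connected graph. -/
theorem avg_eq_of_tracking (hκ : κ ≠ 0) (h1 : Matrix.toEuclideanLin G.L σ = 0)
    (h2 : κ • (σ - β) + Matrix.toEuclideanLin G.L ψ = 0) (n : Fin N) : σ n = Network.avg β := by
  have hN : (N : ℝ) ≠ 0 := by
    have := n.pos
    positivity
  have hsum : ∑ m, (κ • (σ - β) + Matrix.toEuclideanLin G.L ψ) m = 0 := by
    rw [h2]; simp
  simp only [PiLp.add_apply, PiLp.smul_apply, PiLp.sub_apply, smul_eq_mul,
    Finset.sum_add_distrib, G.sum_L_apply, ← Finset.mul_sum, Finset.sum_sub_distrib,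
    add_zero] at hsum
  have h3 := (mul_eq_zero.1 hsum).resolve_left hκ
  have h4 : ∑ m, σ m = N * σ n := by
    rw [Finset.sum_congr rfl fun m _ => G.eq_of_L_eq_zero h1 m n]
    simp
  rw [Network.avg, eq_div_iff hN]
  linarith

theorem inner_Abar_transpose_const {l : CIdx N H → ℝ} (hl : ∀ n i, lam (n, i) = l i) (u : Vec N) :
    inner ℝ (Matrix.toEuclideanLin g.Abarᵀ lam) u = ∑ i, l i * (g.Atil *ᵥ u) i := by
  rw [g.inner_Abar_transpose, PiLp.inner_apply, Fintype.sum_prod_type, Finset.sum_comm]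
  refine Finset.sum_congr rfl fun i _ => ?_
  rw [← g.sum_Abar_apply, Finset.mul_sum]
  refine Finset.sum_congr rfl fun n _ => ?_
  rw [hl]
  simp [mul_comm]

/-- The bids of a solution of the optimality system solve the variational inequality. -/
theorem SolvesKKT.solvesVI (hN : 0 < N) (hκ : κ ≠ 0) (h : SolvesKKT g G κ β ψ σ z lam) :
    g.SolvesVI β := by
  have hF := g.FLoc_avg (avg_eq_of_tracking hκ h.consensus_σ h.tracking)
  have hl : ∀ n i, lam (n, i) = lam (⟨0, hN⟩, i) := fun n i => by
    have : Matrix.toEuclideanLin G.L (col lam i) = 0 := by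
      rw [← G.col_Llam, h.consensus_lam]
      rfl
    exact G.eq_of_L_eq_zero this n ⟨0, hN⟩
  set l : CIdx N H → ℝ := fun i => lam (⟨0, hN⟩, i) with hldef
  have hl0 : ∀ i, 0 ≤ l i := fun i => h.lam_nonneg _
  set R := g.dbar + Matrix.toEuclideanLin (G.Llam H) lam
    - Matrix.toEuclideanLin g.Abar β + Matrix.toEuclideanLin (G.Llam H) z with hR
  -- Summation over aggregators removes the `z` term and reassembles the global slack from the local
  -- data.
  have hsumR : ∀ i, ∑ n, R (n, i) = g.d i - (g.Atil *ᵥ β) i := fun i => by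
    have e : ∀ n, R (n, i) = g.dLoc n i - Matrix.toEuclideanLin g.Abar β (n, i)
        + Matrix.toEuclideanLin G.L (col z i) n := fun n => by
      rw [hR, h.consensus_lam, add_zero, PiLp.add_apply, PiLp.sub_apply, G.Llam_apply]
      rfl
    simp only [e]
    rw [Finset.sum_add_distrib, Finset.sum_sub_distrib, G.sum_L_apply, g.sum_Abar_apply,
      g.sum_dLoc hN, add_zero]
  have hinner : ∀ v : CIdx N H → ℝ,
      inner ℝ R (WithLp.toLp 2 fun p : Fin N × CIdx N H => v p.2)
        = ∑ i, v i * (g.d i - (g.Atil *ᵥ β) i) := fun v => by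
    rw [PiLp.inner_apply, Fintype.sum_prod_type, Finset.sum_comm]
    refine Finset.sum_congr rfl fun i _ => ?_
    rw [← hsumR, Finset.mul_sum]
    exact Finset.sum_congr rfl fun n _ => by simp
  have hlam : lam = WithLp.toLp 2 fun p : Fin N × CIdx N H => l p.2 := by
    ext ⟨n, i⟩
    exact hl n i
  have hfeas : ∀ i, (g.Atil *ᵥ β) i ≤ g.d i := fun i => by
    -- Raising the `i`-th multiplier of every aggregator by one tests the global slack of constraint
    -- `i`.
    have h1 := h.dual (lam + WithLp.toLp 2 fun p : Fin N × CIdx N H => if p.2 = i then 1 else 0)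
      (fun p => by
        have : (0 : ℝ) ≤ if p.2 = i then 1 else 0 := by split_ifs <;> norm_num
        exact add_nonneg (h.lam_nonneg p) this)
    rw [add_sub_cancel_left, hinner fun j => if j = i then 1 else 0] at h1
    simp only [ite_mul, one_mul, zero_mul, Finset.sum_ite_eq', Finset.mem_univ,
      if_true] at h1
    linarith
  have hcompl : ∑ i, l i * (g.d i - (g.Atil *ᵥ β) i) ≤ 0 := by
    -- Testing with zero gives the half of complementary slackness that is needed.
    have h1 := h.dual 0 (fun p => le_rfl)
    have h2 := hinner l
    rw [← hlam] at h2
    rw [zero_sub, inner_neg_right, h2] at h1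
    linarith
  refine ⟨⟨h.mem_Omega, hfeas⟩, fun y hy => ?_⟩
  have h1 := h.bid y hy.1
  rw [hF, inner_add_left, inner_Abar_transpose_const hl] at h1
  have h2 : ∑ i, l i * (g.Atil *ᵥ (y - β : Vec N)) i
      ≤ ∑ i, l i * (g.d i - (g.Atil *ᵥ β) i) := by
    refine Finset.sum_le_sum fun i _ => mul_le_mul_of_nonneg_left ?_ (hl0 i)
    have : (g.Atil *ᵥ (y - β : Vec N)) i = (g.Atil *ᵥ y) i - (g.Atil *ᵥ β) i := by
      change g.AtilLin (y - β) i = _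
      rw [map_sub]
      rfl
    rw [this]
    linarith [hy.2 i]
  rw [real_inner_comm]
  linarith

/-- The optimality system is solvable. -/
theorem exists_solvesKKT (hsl : g.Slater) (hκ : κ ∈ g.kappaInterval) :
    ∃ (β ψ σ : Vec N) (z lam : BigVec N H), SolvesKKT g G κ β ψ σ z lam := by
  have hN : 0 < N := by have := Network.two_le_of_kappa hκ; omega
  have hN' : (N : ℝ) ≠ 0 := by positivity
  obtain ⟨y₀, hy₀, hs₀⟩ := hsl
  obtain ⟨lip, hlip⟩ := g.exists_lipschitz_F
  obtain ⟨β, hβ, hvi⟩ := exists_solution_of_stronglyMonotone g.isClosed_K g.convex_K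
    ⟨y₀, hy₀, fun i => (hs₀ i).le⟩ g.F (half_pos (Network.iInf_epsUpper_pos hκ))
    (Network.F_stronglyMonotone hκ) hlip
  -- At the solution `β` of the variational inequality, `β` minimizes the linear function `⟨F β, ·⟩`
  -- over `K`.
  obtain ⟨l, hl0, hl⟩ := exists_multiplier_of_slater g.convex_Omega g.AtilLin g.d
    (innerₛₗ ℝ (g.F β)) (p := β) (fun y hy hyd => by
      have := hvi y ⟨hy, hyd⟩
      rw [inner_sub_right] at this
      simp only [innerₛₗ_apply_apply]
      linarith) ⟨y₀, hy₀, hs₀⟩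
  simp only [innerₛₗ_apply_apply] at hl
  have hcompl : ∑ i, l i * (g.d i - (g.Atil *ᵥ β) i) = 0 := by
    have h1 := hl β hβ.1
    have e : ∑ i, l i * (g.AtilLin β i - g.d i) = -∑ i, l i * (g.d i - (g.Atil *ᵥ β) i) := by
      rw [← Finset.sum_neg_distrib]
      refine Finset.sum_congr rfl fun i _ => ?_
      change l i * ((g.Atil *ᵥ β) i - g.d i) = _
      ring
    rw [e] at h1
    have h2 : 0 ≤ ∑ i, l i * (g.d i - (g.Atil *ᵥ β) i) :=
      Finset.sum_nonneg fun i _ => mul_nonneg (hl0 i) (by linarith [hβ.2 i])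
    linarith
  set σ : Vec N := WithLp.toLp 2 fun _ => Network.avg β with hσ
  obtain ⟨ψ, hψ⟩ := G.exists_L_eq (b := -(κ • (σ - β))) (by
    simp only [PiLp.neg_apply, PiLp.smul_apply, PiLp.sub_apply, smul_eq_mul,
      Finset.sum_neg_distrib, ← Finset.mul_sum]
    have := Network.sum_sub_avg β
    simp only [hσ]
    rw [this]
    simp)
  -- `z` redistributes the local residuals so that each aggregator holds the share `1/N` of the
  -- global slack, which is nonnegative and complementary to `l`. The correction has zero sum, hence
  -- lies in the range of `L`.
  have hz : ∀ i, ∃ zi : Vec N, Matrix.toEuclideanLin G.L zi = WithLp.toLp 2 fun n =>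
      (1 / (N : ℝ)) * (g.d i - (g.Atil *ᵥ β) i) - g.dLoc n i
        + Matrix.toEuclideanLin g.Abar β (n, i) := fun i => G.exists_L_eq (by
    simp only
    rw [Finset.sum_add_distrib, Finset.sum_sub_distrib, g.sum_Abar_apply, g.sum_dLoc hN,
      Finset.sum_const, Finset.card_univ, Fintype.card_fin, nsmul_eq_mul]
    field_simp
    ring)
  choose zc hzc using hz
  set lam : BigVec N H := WithLp.toLp 2 fun p => l p.2 with hlam
  set z : BigVec N H := WithLp.toLp 2 fun p => zc p.2 p.1 with hzdef
  have hLσ : Matrix.toEuclideanLin G.L σ = 0 := by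
    ext n
    rw [G.L_apply]
    simp [σ]
  have hLlam : Matrix.toEuclideanLin (G.Llam H) lam = 0 := by
    ext ⟨n, i⟩
    rw [G.Llam_apply, G.L_apply]
    simp [col, lam]
  refine ⟨β, ψ, σ, z, lam, hβ.1, fun p => hl0 _, fun y hy => ?_, hLσ, ?_, hLlam, fun y hy => ?_⟩
  · rw [g.FLoc_avg (σ := σ) fun n => rfl, inner_add_left,
      inner_Abar_transpose_const (l := l) fun n i => rfl]
    have h1 := hl y hy
    rw [inner_sub_right]
    have e : ∑ i, l i * (g.Atil *ᵥ (y - β : Vec N)) i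
        = ∑ i, l i * (g.AtilLin y i - g.d i) + ∑ i, l i * (g.d i - (g.Atil *ᵥ β) i) := by
      rw [← Finset.sum_add_distrib]
      refine Finset.sum_congr rfl fun i _ => ?_
      change l i * g.AtilLin (y - β) i = l i * (g.AtilLin y i - g.d i)
        + l i * (g.d i - g.AtilLin β i)
      rw [map_sub, Pi.sub_apply]
      ring
    rw [e, hcompl]
    linarith
  · rw [hψ, add_neg_cancel]
  · have e : ∀ n i, (g.dbar + Matrix.toEuclideanLin (G.Llam H) lam
        - Matrix.toEuclideanLin g.Abar β + Matrix.toEuclideanLin (G.Llam H) z) (n, i)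
        = (1 / (N : ℝ)) * (g.d i - (g.Atil *ᵥ β) i) := fun n i => by
      rw [hLlam, add_zero, PiLp.add_apply, PiLp.sub_apply, G.Llam_apply]
      have : col z i = zc i := rfl
      rw [this, hzc]
      have : g.dbar (n, i) = g.dLoc n i := rfl
      rw [this]
      ring
    rw [inner_sub_right]
    have e1 : inner ℝ (g.dbar + Matrix.toEuclideanLin (G.Llam H) lam
        - Matrix.toEuclideanLin g.Abar β + Matrix.toEuclideanLin (G.Llam H) z) lam = 0 := by
      rw [PiLp.inner_apply, Fintype.sum_prod_type]
      refine Finset.sum_eq_zero fun n _ => ?_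
      have : ∀ i, inner ℝ ((g.dbar + Matrix.toEuclideanLin (G.Llam H) lam
          - Matrix.toEuclideanLin g.Abar β + Matrix.toEuclideanLin (G.Llam H) z) (n, i)) (lam (n, i))
          = (1 / (N : ℝ)) * (l i * (g.d i - (g.Atil *ᵥ β) i)) := fun i => by
        rw [e]
        simp only [lam, RCLike.inner_apply, conj_trivial]
        ring
      rw [Finset.sum_congr rfl fun i _ => this i, ← Finset.mul_sum, hcompl, mul_zero]
    rw [e1, sub_zero, PiLp.inner_apply]
    refine Finset.sum_nonneg fun p _ => ?_
    obtain ⟨n, i⟩ := p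
    rw [e]
    simp only [RCLike.inner_apply, conj_trivial]
    have h1 : 0 ≤ g.d i - (g.Atil *ᵥ β) i := by linarith [hβ.2 i]
    exact mul_nonneg (hy _) (by positivity)

end KKT

/-! ### Diagonal operators. -/

section Diagonal

variable {ι : Type*} [Fintype ι] [DecidableEq ι]

/-- Coordinatewise scaling. -/
def diagLin (a : ι → ℝ) : EuclideanSpace ℝ ι →ₗ[ℝ] EuclideanSpace ℝ ι :=
  Matrix.toEuclideanLin (Matrix.diagonal a)

theorem diagLin_apply (a : ι → ℝ) (x : EuclideanSpace ℝ ι) (i : ι) :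
    diagLin a x i = a i * x i := by
  rw [diagLin, Matrix.toLpLin_apply]
  exact Matrix.mulVec_diagonal _ _ _

theorem inner_diagLin_comm (a : ι → ℝ) (x y : EuclideanSpace ℝ ι) :
    inner ℝ (diagLin a x) y = inner ℝ x (diagLin a y) :=
  inner_toEuclideanLin_comm (Matrix.isHermitian_diagonal a) x y

theorem inner_diagLin_self (a : ι → ℝ) (x : EuclideanSpace ℝ ι) :
    inner ℝ (diagLin a x) x = ∑ i, a i * x i ^ 2 := by
  rw [PiLp.inner_apply]
  refine Finset.sum_congr rfl fun i _ => ?_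
  rw [diagLin_apply]
  simp only [RCLike.inner_apply, conj_trivial]
  ring

omit [DecidableEq ι] in
theorem mul_norm_sq_eq_sum (c : ℝ) (x : EuclideanSpace ℝ ι) :
    c * ‖x‖ ^ 2 = ∑ i, c * x i ^ 2 := by
  simp [EuclideanSpace.norm_sq_eq, Finset.mul_sum]

theorem mul_norm_sq_le_inner_diagLin {a : ι → ℝ} {c : ℝ} (h : ∀ i, c ≤ a i)
    (x : EuclideanSpace ℝ ι) : c * ‖x‖ ^ 2 ≤ inner ℝ (diagLin a x) x := by
  rw [inner_diagLin_self, mul_norm_sq_eq_sum]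
  exact Finset.sum_le_sum fun i _ => mul_le_mul_of_nonneg_right (h i) (sq_nonneg _)

theorem mul_norm_sq_lt_inner_diagLin {a : ι → ℝ} {c : ℝ} (h : ∀ i, c < a i)
    (x : EuclideanSpace ℝ ι) (hx : x ≠ 0) : c * ‖x‖ ^ 2 < inner ℝ (diagLin a x) x := by
  rw [inner_diagLin_self, mul_norm_sq_eq_sum]
  obtain ⟨j, hj⟩ : ∃ j, x j ≠ 0 := by
    by_contra! hc
    exact hx (PiLp.ext hc)
  exact Finset.sum_lt_sum
    (fun i _ => mul_le_mul_of_nonneg_right (h i).le (sq_nonneg _))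
    ⟨j, Finset.mem_univ j, mul_lt_mul_of_pos_right (h j) (by positivity)⟩

end Diagonal

/-! ### The operators of the algorithm and their hypotheses for convergence. -/

section Operators

variable (g : Network N H) (G : CommGraph N) (κ : ℝ) (s : StepSizes N)

/-- The preconditioning operator of the algorithm. -/
def algPrecond : HSum (Vec N) (BigVec N H) →ₗ[ℝ] HSum (Vec N) (BigVec N H) :=
  precond (diagLin fun n => (s.τ n)⁻¹) (diagLin fun n => (s.υ n)⁻¹) (diagLin fun n => (s.ρ n)⁻¹)
    (Matrix.toEuclideanLin G.L) (diagLin fun p => (s.δ p.1)⁻¹) (diagLin fun p => (s.η p.1)⁻¹)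
    (Matrix.toEuclideanLin (G.Llam H)) (Matrix.toEuclideanLin g.Abar)
    (Matrix.toEuclideanLin g.Abarᵀ)

/-- The skew linear part of `ℬ`. -/
def algSkew : HSum (Vec N) (BigVec N H) →ₗ[ℝ] HSum (Vec N) (BigVec N H) :=
  skewOp (Matrix.toEuclideanLin G.L) (Matrix.toEuclideanLin (G.Llam H))
    (Matrix.toEuclideanLin g.Abar) (Matrix.toEuclideanLin g.Abarᵀ)

/-- The operator `𝒜` on the Hilbert sum. -/
def algSmooth (x : HSum (Vec N) (BigVec N H)) : HSum (Vec N) (BigVec N H) :=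
  hmk (g.FLoc x.fst x.snd.snd.fst) 0 (κ • (x.snd.snd.fst - x.fst)) 0
    (g.dbar + Matrix.toEuclideanLin (G.Llam H) x.snd.snd.snd.snd)

/-- The set whose normal cone is the nonlinear part of `ℬ`. -/
def algSet : Set (HSum (Vec N) (BigVec N H)) :=
  {x | x.fst ∈ g.Omega ∧ ∀ p, 0 ≤ x.snd.snd.snd.snd p}

theorem algSmooth_hmk (β ψ σ : Vec N) (z lam : BigVec N H) :
    algSmooth g G κ (hmk β ψ σ z lam) = hmk (g.FLoc β σ) 0 (κ • (σ - β)) 0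
      (g.dbar + Matrix.toEuclideanLin (G.Llam H) lam) := rfl

theorem isClosed_algSet : IsClosed (algSet g) := by
  have h := continuous_components (V := Vec N) (W := BigVec N H)
  have e : algSet g = (fun x : HSum (Vec N) (BigVec N H) => x.fst) ⁻¹' g.Omega
      ∩ ⋂ p, {x : HSum (Vec N) (BigVec N H) | 0 ≤ x.snd.snd.snd.snd p} := by
    ext x
    rw [Set.mem_inter_iff, Set.mem_iInter]
    rfl
  rw [e]
  refine (g.isClosed_Omega.preimage h.fst).inter (isClosed_iInter fun p => ?_)
  have h5 : Continuous fun x : HSum (Vec N) (BigVec N H) => x.snd.snd.snd.snd :=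
    h.snd.snd.snd.snd
  exact isClosed_le continuous_const ((PiLp.continuous_apply 2 _ p).comp h5)

theorem continuous_algSmooth : Continuous (algSmooth g G κ) := by
  have h := continuous_components (V := Vec N) (W := BigVec N H)
  have h1 : Continuous fun x : HSum (Vec N) (BigVec N H) => x.fst := h.fst
  have h3 : Continuous fun x : HSum (Vec N) (BigVec N H) => x.snd.snd.fst := h.snd.snd.fst
  have h5 : Continuous fun x : HSum (Vec N) (BigVec N H) => x.snd.snd.snd.snd :=
    h.snd.snd.snd.snd
  have hL : Continuous (Matrix.toEuclideanLin (G.Llam H)) :=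
    LinearMap.continuous_of_finiteDimensional _
  refine continuous_hmk ?_ continuous_const ((h3.sub h1).const_smul κ) continuous_const
    (continuous_const.add (hL.comp h5))
  refine (PiLp.continuous_toLp 2 _).comp (continuous_pi fun n => ?_)
  simp only [Network.fLoc_eq]
  have hb : Continuous fun x : HSum (Vec N) (BigVec N H) => x.fst n :=
    (PiLp.continuous_apply 2 _ n).comp h1
  have hs : Continuous fun x : HSum (Vec N) (BigVec N H) => x.snd.snd.fst n :=
    (PiLp.continuous_apply 2 _ n).comp h3
  fun_prop

variable {g G κ s}

theorem eps_pos (hκ : κ ∈ g.kappaInterval) : 0 < eps g G κ :=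
  lt_min (Network.epsTil_pos hκ)
    (one_div_pos.2 (G.lamMax_L_pos (Network.two_le_of_kappa hκ)))

/-- Cocoercivity of `𝒜`. -/
theorem algSmooth_cocoercive (hκ : κ ∈ g.kappaInterval) (x y : HSum (Vec N) (BigVec N H)) :
    eps g G κ * ‖algSmooth g G κ x - algSmooth g G κ y‖ ^ 2
      ≤ inner ℝ (algSmooth g G κ x - algSmooth g G κ y) (x - y) := by
  obtain ⟨β, ψ, σ, z, lam, rfl⟩ := exists_eq_hmk x
  obtain ⟨β', ψ', σ', z', lam', rfl⟩ := exists_eq_hmk y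
  have hε := eps_pos (G := G) hκ
  have hl := G.lamMax_L_pos (Network.two_le_of_kappa hκ)
  rw [algSmooth_hmk, algSmooth_hmk, hmk_sub, hmk_sub, norm_sq_hmk, inner_hmk]
  simp only [sub_self, norm_zero, inner_zero_left, add_sub_add_left_eq_sub, ← map_sub, ← smul_sub]
  have h1 : eps g G κ * ‖Matrix.toEuclideanLin (G.Llam H) (lam - lam')‖ ^ 2
      ≤ inner ℝ (Matrix.toEuclideanLin (G.Llam H) (lam - lam')) (lam - lam') := by
    have h2 := G.norm_Llam_sq_le (lam - lam')
    calc _ ≤ 1 / lamMax G.L * ‖Matrix.toEuclideanLin (G.Llam H) (lam - lam')‖ ^ 2 := by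
          gcongr
          exact min_le_right _ _
      _ ≤ _ := by
          rw [one_div, inv_mul_le_iff₀ hl]
          exact h2
  -- The `(β, σ)` part decouples into one 2×2 map per aggregator.
  have h2 : eps g G κ * (‖g.FLoc β σ - g.FLoc β' σ'‖ ^ 2 + ‖κ • (σ - β - (σ' - β'))‖ ^ 2)
      ≤ inner ℝ (g.FLoc β σ - g.FLoc β' σ') (β - β')
        + inner ℝ (κ • (σ - β - (σ' - β'))) (σ - σ') := by
    have hF : ∀ n, (g.FLoc β σ - g.FLoc β' σ') n
        = g.mu n * (β n - β' n) + g.ell n * (σ n - σ' n) := fun n => g.fLoc_sub n.pos n _ _ _ _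
    rw [EuclideanSpace.norm_sq_eq, EuclideanSpace.norm_sq_eq, ← Finset.sum_add_distrib,
      Finset.mul_sum, PiLp.inner_apply, PiLp.inner_apply, ← Finset.sum_add_distrib]
    refine Finset.sum_le_sum fun n _ => ?_
    rw [hF]
    simp only [PiLp.smul_apply, PiLp.sub_apply, smul_eq_mul, RCLike.inner_apply, conj_trivial,
      Real.norm_eq_abs, sq_abs]
    have h3 := Network.epsTil_mul_le hκ n (β n - β' n) (σ n - σ' n)
    have e : κ * (σ n - β n - (σ' n - β' n)) = κ * ((σ n - σ' n) - (β n - β' n)) := by ring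
    rw [e]
    calc _ ≤ g.epsTil κ * ((g.mu n * (β n - β' n) + g.ell n * (σ n - σ' n)) ^ 2
          + (κ * ((σ n - σ' n) - (β n - β' n))) ^ 2) := by
          gcongr
          exact min_le_left _ _
      _ ≤ _ := h3
      _ = _ := by ring
  nlinarith

theorem inner_algSkew_self (x : HSum (Vec N) (BigVec N H)) : inner ℝ (algSkew g G x) x = 0 :=
  inner_skewOp_self (inner_toEuclideanLin_comm G.L_isHermitian) G.inner_Llam_comm
    g.inner_Abar_transpose x

theorem inner_algPrecond_comm (x y : HSum (Vec N) (BigVec N H)) :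
    inner ℝ (algPrecond g G s x) y = inner ℝ x (algPrecond g G s y) :=
  inner_precond_comm (inner_diagLin_comm _) (inner_diagLin_comm _) (inner_diagLin_comm _)
    (inner_diagLin_comm _) (inner_diagLin_comm _) (inner_toEuclideanLin_comm G.L_isHermitian)
    G.inner_Llam_comm g.inner_Abar_transpose x y

/-- The largest step gives a surplus over `1/(2ε)` valid for all `n`; it is positive because the
supremum over finitely many steps is attained. -/
theorem margin_of_step {t : Fin N → ℝ} {ε : ℝ} (hN : 0 < N) (ht : ∀ n, 0 < t n)
    (hlt : ∀ n, t n < 2 * ε) :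
    0 < 1 / (⨆ m, t m) - 1 / (2 * ε) ∧
      ∀ n, 1 / (⨆ m, t m) - 1 / (2 * ε) + 1 / (2 * ε) ≤ (t n)⁻¹ := by
  have : Nonempty (Fin N) := ⟨⟨0, hN⟩⟩
  have hle : ∀ n, t n ≤ ⨆ m, t m := fun n => le_ciSup (Set.finite_range _).bddAbove n
  have hpos : 0 < ⨆ m, t m := (ht ⟨0, hN⟩).trans_le (hle _)
  obtain ⟨m, hm⟩ := exists_eq_ciSup_of_finite (f := t)
  refine ⟨sub_pos.2 (one_div_lt_one_div_of_lt hpos (hm ▸ hlt m)), fun n => ?_⟩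
  rw [sub_add_cancel, ← one_div]
  exact one_div_le_one_div_of_le (ht n) (hle n)

theorem lt_inner_algPrecond_self (hκ : κ ∈ g.kappaInterval) (hs : StepConditions g G κ s)
    (x : HSum (Vec N) (BigVec N H)) (hx : x ≠ 0) :
    1 / (2 * eps g G κ) * ‖x‖ ^ 2 < inner ℝ (algPrecond g G s x) x := by
  have hN2 := Network.two_le_of_kappa hκ
  have hN : 0 < N := by omega
  have hl := G.lamMax_L_pos hN2
  obtain ⟨t0, t1⟩ := margin_of_step hN s.τ_pos hs.τ_lt
  obtain ⟨u0, u1⟩ := margin_of_step hN s.υ_pos hs.υ_lt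
  obtain ⟨d0, d1⟩ := margin_of_step hN s.δ_pos hs.δ_lt
  exact lt_inner_precond_self (a := sigmaMax g.Abar) (l := lamMax G.L) t0 u0 d0
    (mul_norm_sq_le_inner_diagLin t1) (mul_norm_sq_le_inner_diagLin u1)
    (mul_norm_sq_le_inner_diagLin fun p => d1 p.1) (mul_norm_sq_lt_inner_diagLin hs.ρ_inv)
    (mul_norm_sq_lt_inner_diagLin fun p => hs.η_inv p.1)
    (inner_toEuclideanLin_comm G.L_isHermitian) G.inner_Llam_comm g.inner_Abar_transpose
    (fun v => norm_le_mul_of_norm_sq_le hl (G.norm_L_sq_le v))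
    (fun v => norm_le_mul_of_norm_sq_le hl (G.norm_Llam_sq_le v))
    (fun v => (LinearMap.toContinuousLinearMap (Matrix.toEuclideanLin g.Abar)).le_opNorm v) x hx

theorem SolvesKKT.variational {β ψ σ : Vec N} {z lam : BigVec N H}
    (h : SolvesKKT g G κ β ψ σ z lam) {y : HSum (Vec N) (BigVec N H)} (hy : y ∈ algSet g) :
    0 ≤ inner ℝ (algSmooth g G κ (hmk β ψ σ z lam) + algSkew g G (hmk β ψ σ z lam))
      (y - hmk β ψ σ z lam) := by
  obtain ⟨β', ψ', σ', z', lam', rfl⟩ := exists_eq_hmk y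
  rw [algSmooth_hmk, algSkew, skewOp_hmk, hmk_add, hmk_sub, inner_hmk, h.consensus_σ, h.tracking,
    h.consensus_lam]
  have h1 := h.bid β' hy.1
  have h2 := h.dual lam' hy.2
  rw [h.consensus_lam] at h2
  have e : g.dbar + 0 + (-Matrix.toEuclideanLin g.Abar β + Matrix.toEuclideanLin (G.Llam H) z)
      = g.dbar + 0 - Matrix.toEuclideanLin g.Abar β + Matrix.toEuclideanLin (G.Llam H) z := by abel
  rw [e]
  simp only [neg_zero, add_zero, inner_zero_left] at h1 h2 ⊢
  linarith

/-- Solutions of the variational inequality on the Hilbert sum solve the optimality system. -/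
theorem solvesKKT_of_variational {β ψ σ : Vec N} {z lam : BigVec N H}
    (hmem : hmk β ψ σ z lam ∈ algSet g)
    (h : ∀ y ∈ algSet g,
      0 ≤ inner ℝ (algSmooth g G κ (hmk β ψ σ z lam) + algSkew g G (hmk β ψ σ z lam))
        (y - hmk β ψ σ z lam)) : SolvesKKT g G κ β ψ σ z lam := by
  have h' : ∀ (β' ψ' σ' : Vec N) (z' lam' : BigVec N H), β' ∈ g.Omega → (∀ p, 0 ≤ lam' p) → _ :=
    fun β' ψ' σ' z' lam' h1 h2 => h (hmk β' ψ' σ' z' lam') ⟨h1, h2⟩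
  simp only [algSmooth_hmk, algSkew, skewOp_hmk, hmk_add, hmk_sub, inner_hmk, zero_add] at h'
  obtain ⟨hβ, hlam⟩ := hmem
  -- In the unconstrained blocks `ψ`, `σ`, `z`, moving against the residual shows that it vanishes.
  have hself : ∀ {E : Type} [NormedAddCommGroup E] [InnerProductSpace ℝ E] {u : E},
      0 ≤ inner ℝ u (-u) → u = 0 := fun {E} _ _ {u} hu => by
    rw [inner_neg_right] at hu
    have h0 := real_inner_self_nonneg (x := u)
    exact inner_self_eq_zero.1 (le_antisymm (by linarith) h0)
  refine ⟨hβ, hlam, fun y hy => ?_, ?_, ?_, ?_, fun y hy => ?_⟩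
  · simpa using h' y ψ σ z lam hy hlam
  · have := h' β (ψ + Matrix.toEuclideanLin G.L σ) σ z lam hβ hlam
    simp only [sub_self, inner_zero_right, add_sub_cancel_left, zero_add, add_zero] at this
    rw [← neg_eq_zero]
    refine hself ?_
    rwa [neg_neg]
  · have := h' β ψ (σ - (κ • (σ - β) + Matrix.toEuclideanLin G.L ψ)) z lam hβ hlam
    simp only [sub_self, inner_zero_right, sub_sub_cancel_left, zero_add, add_zero] at this
    exact hself this
  · have := h' β ψ σ (z + Matrix.toEuclideanLin (G.Llam H) lam) lam hβ hlam
    simp only [sub_self, inner_zero_right, add_sub_cancel_left, zero_add, add_zero] at this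
    rw [← neg_eq_zero]
    refine hself ?_
    rwa [neg_neg]
  · have := h' β ψ σ z y hβ hy
    simp only [sub_self, inner_zero_right, zero_add] at this
    have e : g.dbar + Matrix.toEuclideanLin (G.Llam H) lam - Matrix.toEuclideanLin g.Abar β
        + Matrix.toEuclideanLin (G.Llam H) z = g.dbar + Matrix.toEuclideanLin (G.Llam H) lam
        + (-Matrix.toEuclideanLin g.Abar β + Matrix.toEuclideanLin (G.Llam H) z) := by abel
    rwa [e]

end Operators

/-! ### The iterates as preconditioned forward-backward steps. -/

section Run

variable {g : Network N H} {G : CommGraph N} {κ : ℝ} {s : StepSizes N}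
  {β ψ σ : ℕ → Vec N} {z lam : ℕ → BigVec N H}

theorem sum_smul_block_apply (v : BigVec N H) (n : Fin N) (i : CIdx N H) :
    (∑ m, G.w n m • (block v n - block v m)) i = Matrix.toEuclideanLin (G.Llam H) v (n, i) := by
  rw [G.Llam_apply, G.L_apply, WithLp.ofLp_sum, Finset.sum_apply]
  rfl

theorem isClosed_nonneg_orthant {ι : Type*} [Fintype ι] :
    IsClosed {v : EuclideanSpace ℝ ι | ∀ i, 0 ≤ v i} := by
  have e : {v : EuclideanSpace ℝ ι | ∀ i, 0 ≤ v i} = ⋂ i, {v | 0 ≤ v i} := by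
    ext v
    rw [Set.mem_iInter]
    rfl
  rw [e]
  exact isClosed_iInter fun i => isClosed_le continuous_const (PiLp.continuous_apply 2 _ i)

theorem nonempty_nonneg_orthant {ι : Type*} :
    {v : EuclideanSpace ℝ ι | ∀ i, 0 ≤ v i}.Nonempty :=
  ⟨0, by
    rw [Set.mem_ofPred_eq]
    exact fun _ => le_rfl⟩

theorem convex_nonneg_orthant {ι : Type*} [Fintype ι] :
    Convex ℝ {v : EuclideanSpace ℝ ι | ∀ i, 0 ≤ v i} :=
  fun _ hx _ hy _ _ ha hb _ i => add_nonneg (mul_nonneg ha (hx i)) (mul_nonneg hb (hy i))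

/-- The variational inequality characterizing a projected step. -/
theorem inner_proj_step_nonneg {E : Type*} [NormedAddCommGroup E] [InnerProductSpace ℝ E]
    [FiniteDimensional ℝ E] {S : Set E} (hS : IsClosed S) (hconv : Convex ℝ S)
    (hne : S.Nonempty) {x x' v : E} {t : ℝ} (ht : 0 < t) (h : x' = proj S (x - t • v)) {y : E}
    (hy : y ∈ S) : 0 ≤ inner ℝ (t⁻¹ • (x' - x) + v) (y - x') := by
  have h1 := inner_sub_proj_nonpos hS hconv hne (x - t • v) hy
  rw [← h] at h1
  have e : x - t • v - x' = (-t) • (t⁻¹ • (x' - x) + v) := by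
    rw [smul_add, smul_smul, neg_mul, mul_inv_cancel₀ ht.ne']
    module
  rw [e, inner_smul_left] at h1
  simp only [conj_trivial] at h1
  have h2 : 0 ≤ t * inner ℝ (t⁻¹ • (x' - x) + v) (y - x') := by linarith
  exact nonneg_of_mul_nonneg_right h2 ht

theorem inner_eq_sum_block (u v : BigVec N H) :
    inner ℝ u v = ∑ n, inner ℝ (block u n) (block v n) := by
  simp only [PiLp.inner_apply, Fintype.sum_prod_type]
  rfl

variable (hrun : IsRun g G κ s β ψ σ z lam) (hle : g.lo ≤ g.hi)
include hrun

include hle in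
theorem IsRun.bid_mem (k : ℕ) : β (k + 1) ∈ g.Omega := fun n => by
  rw [hrun.β_step]
  exact (proj_spec isClosed_Icc (Set.nonempty_Icc.2 hle) _).1

theorem IsRun.lam_nonneg (k : ℕ) (p : Fin N × CIdx N H) : 0 ≤ lam (k + 1) p := by
  have h : block (lam (k + 1)) p.1 ∈ {v : CVec N H | ∀ i, 0 ≤ v i} := by
    rw [hrun.lam_step]
    exact (proj_spec isClosed_nonneg_orthant nonempty_nonneg_orthant _).1
  exact h p.2

-- `Ω` is a product of intervals, so the coordinatewise projection inequalities, each divided by its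
-- own step, add up.
include hle in
theorem IsRun.bid_variational (k : ℕ) {y : Vec N} (hy : y ∈ g.Omega) :
    0 ≤ inner ℝ (diagLin (fun n => (s.τ n)⁻¹) (β (k + 1) - β k) + g.FLoc (β k) (σ k)
      + Matrix.toEuclideanLin g.Abarᵀ (lam k)) (y - β (k + 1)) := by
  rw [PiLp.inner_apply]
  refine Finset.sum_nonneg fun n _ => ?_
  have h := inner_proj_step_nonneg isClosed_Icc (convex_Icc _ _) (Set.nonempty_Icc.2 hle)
    (s.τ_pos n) (hrun.β_step k n) (hy n)
  rw [PiLp.add_apply, PiLp.add_apply, diagLin_apply, g.Abar_transpose_apply, add_assoc]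
  exact h

theorem IsRun.psi_eq (k : ℕ) : diagLin (fun n => (s.υ n)⁻¹) (ψ (k + 1) - ψ k)
    = Matrix.toEuclideanLin G.L (σ k) := by
  ext n
  rw [diagLin_apply, PiLp.sub_apply, hrun.ψ_step, G.L_apply, add_sub_cancel_left,
    inv_mul_cancel_left₀ (s.υ_pos n).ne']

theorem IsRun.sigma_eq (k : ℕ) : diagLin (fun n => (s.ρ n)⁻¹) (σ (k + 1) - σ k)
    = κ • (β k - σ k) - Matrix.toEuclideanLin G.L ((2 : ℝ) • ψ (k + 1) - ψ k) := by
  ext n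
  rw [diagLin_apply, PiLp.sub_apply, hrun.σ_step, add_sub_cancel_left,
    inv_mul_cancel_left₀ (s.ρ_pos n).ne', PiLp.sub_apply, G.L_apply]
  congr 1
  refine Finset.sum_congr rfl fun m _ => ?_
  simp only [PiLp.sub_apply, PiLp.smul_apply, smul_eq_mul]
  ring

theorem IsRun.z_eq (k : ℕ) : diagLin (fun p => (s.δ p.1)⁻¹) (z (k + 1) - z k)
    = Matrix.toEuclideanLin (G.Llam H) (lam k) := by
  ext ⟨n, i⟩
  have h := congrArg (fun v : CVec N H => v i) (hrun.z_step k n)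
  simp only [PiLp.add_apply, PiLp.smul_apply, smul_eq_mul] at h
  rw [sum_smul_block_apply] at h
  have h' : z (k + 1) (n, i) = z k (n, i)
      + s.δ n * Matrix.toEuclideanLin (G.Llam H) (lam k) (n, i) := h
  rw [diagLin_apply, PiLp.sub_apply, h', add_sub_cancel_left,
    inv_mul_cancel_left₀ (s.δ_pos n).ne']

/-- The same blockwise argument; `η` is constant on each block, so every block is a genuine
projection onto the orthant. -/
theorem IsRun.dual_variational (k : ℕ) {y : BigVec N H} (hy : ∀ p, 0 ≤ y p) :
    0 ≤ inner ℝ (diagLin (fun p => (s.η p.1)⁻¹) (lam (k + 1) - lam k)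
      + (Matrix.toEuclideanLin (G.Llam H) (lam k) + g.dbar
        + Matrix.toEuclideanLin g.Abar (β k - (2 : ℝ) • β (k + 1))
        + Matrix.toEuclideanLin (G.Llam H) ((2 : ℝ) • z (k + 1) - z k))) (y - lam (k + 1)) := by
  rw [inner_eq_sum_block]
  refine Finset.sum_nonneg fun n _ => ?_
  have h := inner_proj_step_nonneg isClosed_nonneg_orthant convex_nonneg_orthant
    nonempty_nonneg_orthant (s.η_pos n) (hrun.lam_step k n) (y := block y n) (fun i => hy _)
  refine h.trans_eq ?_
  congr 1
  ext i
  have e1 : (∑ m, G.w n m • ((2 : ℝ) • (block (z (k + 1)) n - block (z (k + 1)) m)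
      - (block (z k) n - block (z k) m)))
      = ∑ m, G.w n m • (block ((2 : ℝ) • z (k + 1) - z k) n
        - block ((2 : ℝ) • z (k + 1) - z k) m) := by
    refine Finset.sum_congr rfl fun m _ => ?_
    congr 1
    ext j
    simp only [block, PiLp.sub_apply, PiLp.smul_apply, smul_eq_mul]
    ring
  rw [e1]
  simp only [PiLp.add_apply, PiLp.smul_apply, PiLp.sub_apply, smul_eq_mul, sum_smul_block_apply]
  simp only [block, PiLp.add_apply, diagLin_apply, PiLp.sub_apply, g.Abar_apply, PiLp.smul_apply,
    smul_eq_mul, Network.dbar]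
  ring

include hle in
/-- Each iteration of the algorithm is a preconditioned forward-backward step. -/
theorem IsRun.variational (k : ℕ) {y : HSum (Vec N) (BigVec N H)} (hy : y ∈ algSet g) :
    0 ≤ inner ℝ
      (algPrecond g G s (hmk (β (k + 1)) (ψ (k + 1)) (σ (k + 1)) (z (k + 1)) (lam (k + 1))
          - hmk (β k) (ψ k) (σ k) (z k) (lam k))
        + algSmooth g G κ (hmk (β k) (ψ k) (σ k) (z k) (lam k))
        + algSkew g G (hmk (β (k + 1)) (ψ (k + 1)) (σ (k + 1)) (z (k + 1)) (lam (k + 1))))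
      (y - hmk (β (k + 1)) (ψ (k + 1)) (σ (k + 1)) (z (k + 1)) (lam (k + 1))) := by
  obtain ⟨β', ψ', σ', z', lam', rfl⟩ := exists_eq_hmk y
  rw [hmk_sub, algPrecond, precond_hmk, algSmooth_hmk, algSkew, skewOp_hmk, hmk_add, hmk_add,
    hmk_sub, inner_hmk, hrun.psi_eq, hrun.sigma_eq, hrun.z_eq]
  have h1 := hrun.bid_variational hle k hy.1
  have h2 := hrun.dual_variational k hy.2
  -- In `e1`, `e2`, `e4` the new iterates cancel from the coupling terms; in `e3` and `e5` they
  -- combine into the extrapolations. The `ψ`, `σ`, `z` rows vanish, leaving two projection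
  -- inequalities.
  have e1 : diagLin (fun n => (s.τ n)⁻¹) (β (k + 1) - β k)
        - Matrix.toEuclideanLin g.Abarᵀ (lam (k + 1) - lam k) + g.FLoc (β k) (σ k)
        + Matrix.toEuclideanLin g.Abarᵀ (lam (k + 1))
      = diagLin (fun n => (s.τ n)⁻¹) (β (k + 1) - β k) + g.FLoc (β k) (σ k)
        + Matrix.toEuclideanLin g.Abarᵀ (lam k) := by
    rw [map_sub (Matrix.toEuclideanLin g.Abarᵀ)]; abel
  have e2 : Matrix.toEuclideanLin G.L (σ k) + Matrix.toEuclideanLin G.L (σ (k + 1) - σ k) + 0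
      + -Matrix.toEuclideanLin G.L (σ (k + 1)) = 0 := by
    rw [map_sub]; abel
  have e3 : κ • (β k - σ k) - Matrix.toEuclideanLin G.L ((2 : ℝ) • ψ (k + 1) - ψ k)
      + Matrix.toEuclideanLin G.L (ψ (k + 1) - ψ k) + κ • (σ k - β k)
      + Matrix.toEuclideanLin G.L (ψ (k + 1)) = 0 := by
    rw [map_sub, map_sub, map_smul]; module
  have e4 : Matrix.toEuclideanLin (G.Llam H) (lam k)
      + Matrix.toEuclideanLin (G.Llam H) (lam (k + 1) - lam k) + 0
      + -Matrix.toEuclideanLin (G.Llam H) (lam (k + 1)) = 0 := by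
    rw [map_sub]; abel
  have e5 : diagLin (fun p => (s.η p.1)⁻¹) (lam (k + 1) - lam k)
      - Matrix.toEuclideanLin g.Abar (β (k + 1) - β k)
      + Matrix.toEuclideanLin (G.Llam H) (z (k + 1) - z k)
      + (g.dbar + Matrix.toEuclideanLin (G.Llam H) (lam k))
      + (-Matrix.toEuclideanLin g.Abar (β (k + 1)) + Matrix.toEuclideanLin (G.Llam H) (z (k + 1)))
      = diagLin (fun p => (s.η p.1)⁻¹) (lam (k + 1) - lam k)
      + (Matrix.toEuclideanLin (G.Llam H) (lam k) + g.dbar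
        + Matrix.toEuclideanLin g.Abar (β k - (2 : ℝ) • β (k + 1))
        + Matrix.toEuclideanLin (G.Llam H) ((2 : ℝ) • z (k + 1) - z k)) := by
    simp only [map_sub, map_smul]
    module
  rw [e1, e2, e3, e4, e5]
  simp only [inner_zero_left, add_zero]
  exact add_nonneg h1 h2

end Run

end AggGame

end

/-! ### Assembly of the main theorem. -/

theorem theorem2 {N H : ℕ} (g : Network N H) (hSlater : g.Slater)
    (G : CommGraph N) (κ : ℝ) (hκ : κ ∈ g.kappaInterval)
    (s : StepSizes N) (hs : StepConditions g G κ s)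
    (β ψ σ : ℕ → Vec N) (z lam : ℕ → BigVec N H)
    (hrun : IsRun g G κ s β ψ σ z lam) :
    ∃ (βs ψs σs : Vec N) (zs lams : BigVec N H),
      IsZeroAB g G κ (βs, ψs, σs, zs, lams) ∧
      Tendsto (fun k => (β k, ψ k, σ k, z k, lam k)) atTop (𝓝 (βs, ψs, σs, zs, lams)) ∧
      Tendsto β atTop (𝓝 βs) ∧
      g.IsVGNE βs := by
  have hN : 0 < N := by have := Network.two_le_of_kappa hκ; omega
  -- The Slater point shows that the bid intervals are nonempty, which the projections require.
  have hle : g.lo ≤ g.hi := by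
    obtain ⟨y, hy, -⟩ := hSlater
    exact (hy ⟨0, hN⟩).1.trans (hy ⟨0, hN⟩).2
  obtain ⟨βp, ψp, σp, zp, lamp, hp⟩ := exists_solvesKKT (G := G) hSlater hκ
  obtain ⟨q, hqS, hq, hlim⟩ := forwardBackward_tendsto (isClosed_algSet g) (algSmooth g G κ)
    (continuous_algSmooth g G κ) (algSkew g G) (algPrecond g G s) inner_algSkew_self
    inner_algPrecond_comm (eps_pos (G := G) hκ) (algSmooth_cocoercive hκ)
    (lt_inner_algPrecond_self hκ hs) (p := hmk βp ψp σp zp lamp) ⟨hp.mem_Omega, hp.lam_nonneg⟩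
    (fun y hy => hp.variational hy) (fun k => hmk (β k) (ψ k) (σ k) (z k) (lam k))
    (fun k => ⟨hrun.bid_mem hle k, hrun.lam_nonneg k⟩) (fun k y hy => hrun.variational hle k hy)
  obtain ⟨βs, ψs, σs, zs, lams, rfl⟩ := exists_eq_hmk q
  have hkkt := solvesKKT_of_variational hqS hq
  have hlim' : Tendsto (fun k => (β k, ψ k, σ k, z k, lam k)) atTop
      (𝓝 (βs, ψs, σs, zs, lams)) := (continuous_components.tendsto _).comp hlim
  exact ⟨βs, ψs, σs, zs, lams, hkkt.isZeroAB, hlim', (continuous_fst.tendsto _).comp hlim',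
    (hkkt.solvesVI hN (Network.kappa_pos hκ).ne').isVGNE⟩
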